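/- Notation. For a partition $\lambda=(\lambda_1\ge\lambda_2\ge\dots)$ write $l(\lambda)$ for its number of parts and $|\mathrm{Aut}\,\lambda|=\prod_{i\ge1}m_i!$, where $m_i$ is the multiplicity of $i$ in $\lambda$. For $\lambda,\mu\vdash d$ let $\chi^\lambda_\mu$ be the irreducible character of the symmetric group $S_d$ associated with $\lambda$, evaluated at a permutation of cycle type $\mu$, and let $$p_k(\lambda)=\sum_{i\ge1}\Bigl(\bigl(\lambda_i-i+\tfrac12\bigr)^k-\bigl(-i+\tfrac12\bigr)^k\Bigr).$$ For partitions $\alpha,\beta$ of $d>0$ and integers $g,s\ge0$, $r\ge1$ with $rs=2g-2+l(\alpha)+l(\beta)$, the (disconnected) double Hurwitz number with completed $(r+1)$-cycles is $$H^{g,(r)}_{\alpha,\beta}=\frac{1}{\prod_i\alpha_i\prod_j\beta_j}\sum_{\lambda\vdash d}\chi^\lambda_\alpha\left(\frac{p_{r+1}(\lambda)}{(r+1)!}\right)^{s}\chi^\lambda_\beta .$$ Theorem. Let $g\ge0$ and $d>0$ be integers, let $\beta$ be a partition of $d$ of odd length $n$, and let $s$ be the integer with $2s=2g-1+n$. Let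 $n_i$ be the multiplicity of $i$ in $\beta$, and put $c_1=n_1-1$ and $c_i=n_i$ for $i\ge2$. For $j\ge1$ put $\xi_{2j}=[x^{2j}]\log(\sinh x/x)$ and $S_{2j}=\sum_{k\ge1}k^{2j}c_k$, and for a partition $\lambda$ put $\xi_{2\lambda}=\prod_i\xi_{2\lambda_i}$ and $S_{2\lambda}=\prod_iS_{2\lambda_i}$. Then \begin{align*} H^{g,(2)}_{(d),\beta}&=\frac{s!\,d^{s-1}}{2^s}\sum_{h=0}^g\frac{(2s-2h)!}{h!\,(s-h)!\,12^h}\,d^{2h}\,[z^{2(g-h)}]\prod_{i\ge1}\left(\frac{\sinh(iz/2)}{iz/2}\right)^{c_i}\\ &=\frac{s!\,d^{s-1}}{2^{s+2g}}\sum_{h=0}^g\frac{(2s-2h)!}{h!\,(s-h)!\,3^h}\,d^{2h}\sum_{\lambda\vdash g-h}\frac{\xi_{2\lambda}S_{2\lambda}}{|\mathrm{Aut}\,\lambda|}. \end{align*} -/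

import Mathlib

open Equiv PowerSeries

noncomputable section

namespace Hurwitz

/-! ### Partitions -/

/-- The parts `λ₁ ≥ λ₂ ≥ … ≥ λ_m` of a partition, as a weakly decreasing list. -/
def sortedParts {d : ℕ} (lam : d.Partition) : List ℕ :=
  lam.parts.sort (· ≥ ·)

/-- The length `l(λ)` of a partition. -/
def len {d : ℕ} (lam : d.Partition) : ℕ := lam.parts.card

/-- `|Aut λ| = m₁! m₂! ⋯`, where `m_i` is the multiplicity of `i` in `λ`. -/
def autCard {d : ℕ} (lam : d.Partition) : ℕ :=
  ∏ i ∈ lam.parts.toFinset, (lam.parts.count i).factorial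

/-! ### Irreducible characters of the symmetric group -/

theorem sortedParts_sortedGE {d : ℕ} (lam : d.Partition) : (sortedParts lam).SortedGE :=
  (Multiset.pairwise_sort lam.parts (· ≥ ·)).sortedGE

/-- The Young diagram of a partition: row `i` has `λ_{i+1}` cells. -/
def youngDiagram {d : ℕ} (lam : d.Partition) : YoungDiagram :=
  YoungDiagram.ofRowLens (sortedParts lam) (sortedParts_sortedGE lam)

theorem card_cellsOfRowLens (w : List ℕ) : (YoungDiagram.cellsOfRowLens w).card = w.sum := by
  induction w with
  | nil => simp [YoungDiagram.cellsOfRowLens]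
  | cons a w ih =>
    rw [YoungDiagram.cellsOfRowLens, Finset.card_union_of_disjoint]
    · simp [ih]
    · rw [Finset.disjoint_left]
      rintro ⟨i, j⟩ h1 h2
      simp at h1 h2
      omega

theorem card_cells_youngDiagram {d : ℕ} (lam : d.Partition) :
    (youngDiagram lam).cells.card = d := by
  change (YoungDiagram.cellsOfRowLens (sortedParts lam)).card = d
  rw [card_cellsOfRowLens, ← Multiset.sum_coe, sortedParts, Multiset.sort_eq, lam.parts_sum]

/-- A (bijective) Young tableau of shape `λ ⊢ d`, placing each of the `d` letters in a cell. -/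
abbrev Tableau {d : ℕ} (lam : d.Partition) : Type :=
  Fin d ≃ (youngDiagram lam).cells

theorem nonempty_tableau {d : ℕ} (lam : d.Partition) : Nonempty (Tableau lam) :=
  ⟨Fintype.equivOfCardEq (by simp [card_cells_youngDiagram])⟩

/-- The row of the tableau containing a letter. -/
def Tableau.row {d : ℕ} {lam : d.Partition} (t : Tableau lam) (x : Fin d) : ℕ := (t x).1.1

/-- The column of the tableau containing a letter. -/
def Tableau.col {d : ℕ} {lam : d.Partition} (t : Tableau lam) (x : Fin d) : ℕ := (t x).1.2

/-- The group algebra `ℚ S_d`. -/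
abbrev GroupAlg (d : ℕ) : Type := MonoidAlgebra ℚ (Perm (Fin d))

/-- The sum of all permutations preserving the rows of the tableau. -/
def rowSymmetrizer {d : ℕ} {lam : d.Partition} (t : Tableau lam) : GroupAlg d :=
  ∑ σ : Perm (Fin d) with ∀ x, Tableau.row t (σ x) = Tableau.row t x, MonoidAlgebra.single σ 1

/-- The signed sum of all permutations preserving the columns of the tableau. -/
def colAntisymmetrizer {d : ℕ} {lam : d.Partition} (t : Tableau lam) : GroupAlg d :=
  ∑ σ : Perm (Fin d) with ∀ x, Tableau.col t (σ x) = Tableau.col t x,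
    MonoidAlgebra.single σ ((Perm.sign σ : ℤ) : ℚ)

/-- The Young symmetrizer of a tableau. -/
def youngSymmetrizer {d : ℕ} {lam : d.Partition} (t : Tableau lam) : GroupAlg d :=
  rowSymmetrizer t * colAntisymmetrizer t

/-- The Specht module: the left ideal of `ℚ S_d` generated by the Young symmetrizer. It is the
irreducible `S_d`-module associated with `λ`; `λ = (d)` gives the trivial module. -/
abbrev SpechtModule {d : ℕ} {lam : d.Partition} (t : Tableau lam) :
    Submodule (GroupAlg d) (GroupAlg d) :=
  Submodule.span (GroupAlg d) {youngSymmetrizer t}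

/-- The action of `S_d` on the Specht module by left multiplication. -/
def spechtRep {d : ℕ} {lam : d.Partition} (t : Tableau lam) :
    Representation ℚ (Perm (Fin d)) (SpechtModule t) :=
  ((Algebra.lsmul ℚ ℚ (SpechtModule t) : GroupAlg d →ₐ[ℚ] Module.End ℚ (SpechtModule t)) :
    GroupAlg d →* Module.End ℚ (SpechtModule t)).comp (MonoidAlgebra.of ℚ (Perm (Fin d)))

/-- The irreducible character of `S_d` associated with `λ ⊢ d`. (Different tableaux of shape `λ`
give isomorphic Specht modules, so the chosen tableau is immaterial.) -/
def irrChar {d : ℕ} (lam : d.Partition) (σ : Perm (Fin d)) : ℚ :=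
  (spechtRep (nonempty_tableau lam).some).character σ

theorem exists_perm_of_partition {d : ℕ} (mu : d.Partition) :
    ∃ σ : Perm (Fin d), σ.partition.parts = mu.parts := by
  have hsum : (mu.parts.filter (2 ≤ ·)).sum + (mu.parts.filter (¬ 2 ≤ ·)).sum = d := by
    rw [← Multiset.sum_add, Multiset.filter_add_not, mu.parts_sum]
  have hone : mu.parts.filter (¬ 2 ≤ ·) =
      Multiset.replicate (mu.parts.filter (¬ 2 ≤ ·)).card 1 := by
    rw [Multiset.eq_replicate]
    refine ⟨rfl, fun b hb => ?_⟩
    rw [Multiset.mem_filter] at hb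
    have := mu.parts_pos hb.1
    omega
  obtain ⟨σ, hσ⟩ := (Perm.exists_with_cycleType_iff (Fin d)
    (m := mu.parts.filter (2 ≤ ·))).2 ⟨by rw [Fintype.card_fin]; omega, fun a ha =>
      (Multiset.mem_filter.1 ha).2⟩
  refine ⟨σ, ?_⟩
  rw [Perm.parts_partition, ← Perm.sum_cycleType, hσ, Fintype.card_fin]
  conv_rhs => rw [← Multiset.filter_add_not (2 ≤ ·) mu.parts, hone]
  have h1 : (mu.parts.filter (¬ 2 ≤ ·)).sum = (mu.parts.filter (¬ 2 ≤ ·)).card := by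
    conv_lhs => rw [hone]
    simp
  congr 2
  omega

/-- A permutation of cycle type `μ` (fixed points counted as parts equal to `1`). -/
def permOfPartition {d : ℕ} (mu : d.Partition) : Perm (Fin d) :=
  (exists_perm_of_partition mu).choose

/-- `χ^λ_μ`: the irreducible character associated with `λ`, evaluated on the conjugacy class of
permutations of cycle type `μ`. -/
def chi {d : ℕ} (lam mu : d.Partition) : ℚ :=
  irrChar lam (permOfPartition mu)

/-! ### Double Hurwitz numbers with completed cycles -/

/-- The shifted symmetric power sum
`p_k(λ) = ∑_{i ≥ 1} ((λ_i - i + 1/2)^k - (-i + 1/2)^k)`; the terms with `i > l(λ)` vanish.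
With rows indexed from `0`, `-i + 1/2` becomes `-i - 1/2`. -/
def shiftedPowerSum (k : ℕ) {d : ℕ} (lam : d.Partition) : ℚ :=
  ∑ i : Fin (sortedParts lam).length,
    ((((sortedParts lam).get i : ℚ) - (i : ℚ) - 1 / 2) ^ k - (-(i : ℚ) - 1 / 2) ^ k)

/-- The number `s` of completed `(r+1)`-cycles, determined by `r s = 2g - 2 + l(α) + l(β)`
(for `d > 0` the subtraction does not truncate; the division is exact whenever such an `s`
exists and `r > 0`). -/
def numCycles (g r : ℕ) {d : ℕ} (α β : d.Partition) : ℕ :=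
  (2 * g + len α + len β - 2) / r

/-- The disconnected double Hurwitz number `H^{g,(r)}_{α,β}` with completed `(r+1)`-cycles. -/
def doubleHurwitz (g r : ℕ) {d : ℕ} (α β : d.Partition) : ℚ :=
  1 / ((α.parts.prod : ℚ) * (β.parts.prod : ℚ)) *
    ∑ lam : d.Partition, chi lam α *
      (shiftedPowerSum (r + 1) lam / ((r + 1).factorial : ℚ)) ^ numCycles g r α β * chi lam β

/-! ### The quantities in the explicit formulae -/

/-- `c_1 = n_1 - 1` and `c_i = n_i` for `i ≥ 2`, where `n_i` is the multiplicity of `i` in `β`. -/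
def cExp {d : ℕ} (β : d.Partition) (i : ℕ) : ℤ :=
  (β.parts.count i : ℤ) - if i = 1 then 1 else 0

/-- The formal power series `sinh z = (e^z - e^{-z}) / 2`. -/
def sinhSeries : ℚ⟦X⟧ :=
  C (1 / 2 : ℚ) * (PowerSeries.exp ℚ - rescale (-1 : ℚ) (PowerSeries.exp ℚ))

/-- The formal power series `sinh z / z` (`sinh z` has no constant term). -/
def sinhc : ℚ⟦X⟧ :=
  PowerSeries.mk fun n => coeff (n + 1) sinhSeries

/-- `∏_{i ≥ 1} (sinh(iz/2) / (iz/2))^{c_i}`. As `c_1` may be `-1`, it is formed in the field of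
Laurent series; the factors with `i > d` are `1` when `d ≥ 1`. -/
def sinhProduct {d : ℕ} (β : d.Partition) : LaurentSeries ℚ :=
  ∏ i ∈ Finset.Icc 1 d,
    ((rescale ((i : ℚ) / 2) sinhc : ℚ⟦X⟧) : LaurentSeries ℚ) ^ cExp β i

/-- `ξ_j = [x^j] log (sinh x / x)`. -/
def xi (j : ℕ) : ℚ := coeff j (PowerSeries.logOf sinhc)

/-- `S_j = ∑_{k ≥ 1} k^j c_k` (the terms with `k > d` vanish when `d ≥ 1`). -/
def powS {d : ℕ} (β : d.Partition) (j : ℕ) : ℚ :=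
  ∑ k ∈ Finset.Icc 1 d, (k : ℚ) ^ j * (cExp β k : ℚ)

/-- `ξ_{2λ} = ξ_{2λ₁} ξ_{2λ₂} ⋯`. -/
def xiTwo {k : ℕ} (lam : k.Partition) : ℚ :=
  (lam.parts.map fun a => xi (2 * a)).prod

/-- `S_{2λ} = S_{2λ₁} S_{2λ₂} ⋯`. -/
def powSTwo {d : ℕ} (β : d.Partition) {k : ℕ} (lam : k.Partition) : ℚ :=
  (lam.parts.map fun a => powS β (2 * a)).prod

end Hurwitz

end

noncomputable section

namespace Hurwitz

/-! ### Class averages in a group algebra -/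

section GroupAlgebra

variable {G : Type*} [Group G] [Fintype G]

/-! The character at a `d`-cycle kills every shape except the hooks `(d - k, 1^k)`, where it equals
`(-1)^k` (`chi_eq_zero_of_box`, `chi_hookPartition_indiscrete`). On a hook the third shifted power
sum is elementary: with `u = k - (d - 1)/2`, `p₃/3! = (d/2)(u² + d²/12)`
(`shiftedPowerSum_hookPartition`). The Hurwitz number is thus an alternating sum over `k` of `(u² +
d²/12)^s` times the hook character at `β`, and the binomial theorem reduces it to moments in `u`.

These moments come from `(1 + q) ∑ χ_k q^k = ∏ (1 - (-q)^{β_i})` (`one_add_X_mul_hookPoly`). At `q =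
-e^z`, after multiplication by `e^{-(d-1)z/2}`, the sum becomes `∑ (-1)^k χ_k e^{uz}`, while the
product becomes `z^{n-1} ∏ β_i` times the product of the sinh factors (`exp_mul_aeval_hookPoly`).
Comparing coefficients gives the first formula. The second follows from the exponential formula: `F'
= F G'` determines the coefficients of `F` recursively from those of its logarithm `G`, and the
weighted sums over partitions obey the same recursion (`eq_partitionSum`).

The characters are computed directly from Young symmetrizers. If `c² = n c` with `n ≠ 0`, the
character of the left ideal generated by `c` is a class average of `c` (`trace_span_singleton`); for
hooks `c² = n c` is checked by hand (`IsHook.hookSymmetrizer_mul_self`). Averaging over the choice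
of corner shows that two consecutive hook characters add up to the character induced from trivial ⊗
sign on `S_{d-k} × S_k` (`hookChar_succ_add`), whose values are the coefficients of `det (1 + q
P_σ)` (`classSum_twistedSum_mul_twistedSum`).

For vanishing on other shapes, `∑ (-1)^k χ_k(σ)` is `d` on long cycles and zero elsewhere
(`eval_hookPoly`). Hence the sum of all long cycles is a combination of conjugates of hook
symmetrizers, and these annihilate the Specht module of a non-hook by pigeonhole
(`hookSymmetrizer_mul_mul_youngSymmetrizer`). Taking traces finishes the argument. -/

/-- The class function `σ ↦ ∑_τ x(τ⁻¹ σ τ)` obtained by averaging an element of the group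
algebra over conjugation. -/
def classSum : MonoidAlgebra ℚ G →ₗ[ℚ] (G → ℚ) where
  toFun x σ := ∑ τ : G, x.coeff (τ⁻¹ * σ * τ)
  map_add' x y := by
    funext σ
    simp [Finset.sum_add_distrib]
  map_smul' r x := by
    funext σ
    simp [Finset.mul_sum]

theorem classSum_apply (x : MonoidAlgebra ℚ G) (σ : G) :
    classSum x σ = ∑ τ : G, x.coeff (τ⁻¹ * σ * τ) := rfl

/-- The products `m m'` and `m' m` of group elements are conjugate by `m`, and `τ ↦ τ m` permutes
the averaging index. -/
theorem classSum_mul_comm (x y : MonoidAlgebra ℚ G) : classSum (x * y) = classSum (y * x) := by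
  classical
  induction x using MonoidAlgebra.induction_linear with
  | zero => simp
  | add f g hf hg => simp only [add_mul, mul_add, map_add, hf, hg]
  | single m r =>
    induction y using MonoidAlgebra.induction_linear with
    | zero => simp
    | add f g hf hg => simp only [add_mul, mul_add, map_add, hf, hg]
    | single m' r' =>
      funext σ
      simp only [MonoidAlgebra.single_mul_single, classSum_apply]
      rw [← Equiv.sum_comp (Equiv.mulRight m)
        (fun τ => (MonoidAlgebra.single (m' * m) (r' * r)).coeff (τ⁻¹ * σ * τ))]
      refine Finset.sum_congr rfl fun τ _ => ?_
      rw [MonoidAlgebra.coeff_single, MonoidAlgebra.coeff_single, Finsupp.single_apply,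
        Finsupp.single_apply, mul_comm r]
      refine if_congr ?_ rfl rfl
      simp only [Equiv.coe_mulRight, mul_inv_rev]
      constructor
      · intro h
        calc m' * m = m⁻¹ * (m * m') * m := by group
          _ = _ := by rw [h]; group
      · intro h
        calc m * m' = m * (m' * m) * m⁻¹ := by group
          _ = _ := by rw [h]; group

theorem classSum_conj (g : G) (x : MonoidAlgebra ℚ G) :
    classSum (MonoidAlgebra.single g 1 * x * MonoidAlgebra.single g⁻¹ 1) = classSum x := by
  rw [classSum_mul_comm, ← mul_assoc, MonoidAlgebra.single_mul_single]
  simp [← MonoidAlgebra.one_def]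

/-- The trace of a group element on the left ideal generated by a quasi-idempotent. -/
theorem trace_span_singleton (c : MonoidAlgebra ℚ G) {n : ℚ} (hn : n ≠ 0) (hc : c * c = n • c)
    (σ : G) :
    LinearMap.trace ℚ (Submodule.span (MonoidAlgebra ℚ G) {c})
      (Algebra.lsmul ℚ ℚ (Submodule.span (MonoidAlgebra ℚ G) {c})
        (MonoidAlgebra.of ℚ G σ)) = classSum c σ⁻¹ / n := by
  classical
  -- Right multiplication by `n⁻¹ c` projects the algebra onto the ideal. Hence `T` maps into the
  -- ideal and restricts there to the action of `σ`, so its trace can be read off the basis of group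
  -- elements.
  let T : MonoidAlgebra ℚ G →ₗ[ℚ] MonoidAlgebra ℚ G :=
    LinearMap.mulLeft ℚ (MonoidAlgebra.single σ 1) ∘ₗ LinearMap.mulRight ℚ (n⁻¹ • c)
  have hT : ∀ x, T x = MonoidAlgebra.single σ 1 * (x * (n⁻¹ • c)) := fun x => rfl
  let p : Submodule ℚ (MonoidAlgebra ℚ G) :=
    (Submodule.span (MonoidAlgebra ℚ G) {c}).restrictScalars ℚ
  have hmem : ∀ x, T x ∈ p := by
    intro x
    change T x ∈ Submodule.span (MonoidAlgebra ℚ G) {c}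
    rw [Submodule.mem_span_singleton]
    refine ⟨n⁻¹ • (MonoidAlgebra.single σ 1 * x), ?_⟩
    rw [hT, smul_eq_mul]
    simp [mul_assoc]
  have h1 := LinearMap.trace_restrict_eq_of_forall_mem p T hmem
  have h2 : T.restrict (fun x (_ : x ∈ p) => hmem x) =
      (Algebra.lsmul ℚ ℚ (Submodule.span (MonoidAlgebra ℚ G) {c})
        (MonoidAlgebra.of ℚ G σ)) := by
    ext1 ⟨x, hx⟩
    apply Subtype.ext
    change T x = MonoidAlgebra.single σ 1 * x
    obtain ⟨y, rfl⟩ := Submodule.mem_span_singleton.1 hx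
    rw [hT, smul_eq_mul]
    congr 1
    rw [mul_assoc, mul_smul_comm, hc, smul_smul, inv_mul_cancel₀ hn, one_smul]
  rw [h2] at h1
  refine h1.trans ?_
  rw [LinearMap.trace_eq_matrix_trace ℚ (MonoidAlgebra.basis G ℚ), Matrix.trace, classSum_apply,
    Finset.sum_div]
  refine Finset.sum_congr rfl fun τ _ => ?_
  rw [Matrix.diag_apply, LinearMap.toMatrix_apply, hT]
  have : (MonoidAlgebra.basis G ℚ).repr (MonoidAlgebra.single σ 1 *
      (MonoidAlgebra.basis G ℚ τ * (n⁻¹ • c))) τ = (MonoidAlgebra.single σ 1 *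
      (MonoidAlgebra.single τ 1 * (n⁻¹ • c))).coeff τ := by
    rw [MonoidAlgebra.basis_apply]
    rfl
  rw [this, ← mul_assoc, MonoidAlgebra.single_mul_single, mul_smul_comm, MonoidAlgebra.coeff_smul,
    Finsupp.smul_apply, smul_eq_mul, div_eq_inv_mul]
  congr 1
  -- The diagonal entry at `τ` solves `σ τ m = τ`; this is where `σ⁻¹` enters.
  rw [MonoidAlgebra.coeff_single_mul_eq_mul_coeff (m₂ := τ⁻¹ * σ⁻¹ * τ)]
  · simp
  · intro m _
    constructor
    · intro h
      calc m = (σ * τ)⁻¹ * (σ * τ * m) := by group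
        _ = _ := by rw [h]; group
    · rintro rfl
      group

end GroupAlgebra

/-! ### Twisted sums over Young-type subgroups -/

theorem map_conj_eq {G : Type*} [Group G] (ε : G →* ℚ) (g σ : G) : ε (g * σ * g⁻¹) = ε σ := by
  have h : ε g * ε g⁻¹ = 1 := by rw [← map_mul, mul_inv_cancel, map_one]
  rw [map_mul, map_mul, mul_right_comm, h, one_mul]

section TwistedSum

variable {α : Type*} [Fintype α] [DecidableEq α]

/-- The permutations moving only elements of `s`. -/
def permsOn (s : Finset α) : Finset (Perm α) :=
  {σ | ∀ x, x ∉ s → σ x = x}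

theorem mem_permsOn {s : Finset α} {σ : Perm α} : σ ∈ permsOn s ↔ ∀ x, x ∉ s → σ x = x := by
  simp [permsOn]

theorem mul_mem_permsOn {s : Finset α} {σ τ : Perm α} (hσ : σ ∈ permsOn s) (hτ : τ ∈ permsOn s) :
    σ * τ ∈ permsOn s := by
  rw [mem_permsOn] at *
  intro x hx
  rw [Perm.mul_apply, hτ x hx, hσ x hx]

theorem inv_mem_permsOn {s : Finset α} {σ : Perm α} (hσ : σ ∈ permsOn s) : σ⁻¹ ∈ permsOn s := by
  rw [mem_permsOn] at *
  intro x hx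
  rw [Perm.inv_eq_iff_eq, hσ x hx]

theorem permsOn_mono {s t : Finset α} (h : s ⊆ t) : permsOn s ⊆ permsOn t := by
  intro σ hσ
  rw [mem_permsOn] at *
  exact fun x hx => hσ x fun h' => hx (h h')

theorem swap_mem_permsOn {s : Finset α} {x y : α} (hx : x ∈ s) (hy : y ∈ s) :
    swap x y ∈ permsOn s := by
  rw [mem_permsOn]
  intro z hz
  exact swap_apply_of_ne_of_ne (fun h => hz (h ▸ hx)) (fun h => hz (h ▸ hy))

theorem apply_mem_of_mem_permsOn {s : Finset α} {σ : Perm α} (hσ : σ ∈ permsOn s) {x : α}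
    (hx : x ∈ s) : σ x ∈ s := by
  by_contra h
  rw [mem_permsOn] at hσ
  have := σ.injective (hσ _ h)
  rw [this] at h
  exact h hx

theorem commute_of_mem_permsOn {s t : Finset α} (h : Disjoint s t) {σ τ : Perm α}
    (hσ : σ ∈ permsOn s) (hτ : τ ∈ permsOn t) : Commute σ τ := by
  apply Perm.Disjoint.commute
  intro x
  by_cases hx : x ∈ s
  · exact Or.inr (mem_permsOn.1 hτ x (Finset.disjoint_left.1 h hx))
  · exact Or.inl (mem_permsOn.1 hσ x hx)

theorem card_permsOn (s : Finset α) : (permsOn s).card = s.card.factorial := by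
  have e := Equiv.Perm.subtypeEquivSubtypePerm (fun x => x ∈ s)
  have h := Fintype.card_congr e
  rw [Fintype.card_perm, Fintype.card_coe] at h
  rw [h, permsOn, Fintype.card_subtype]

/-- `∑_σ ε(σ) σ` over the permutations moving only elements of `s`. -/
def twistedSum (ε : Perm α →* ℚ) (s : Finset α) : MonoidAlgebra ℚ (Perm α) :=
  ∑ σ ∈ permsOn s, MonoidAlgebra.single σ (ε σ)

theorem single_mul_twistedSum (ε : Perm α →* ℚ) {s : Finset α} {g : Perm α}
    (hg : g ∈ permsOn s) :
    MonoidAlgebra.single g (ε g) * twistedSum ε s = twistedSum ε s := by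
  rw [twistedSum, Finset.mul_sum]
  refine Finset.sum_bij' (fun σ _ => g * σ) (fun σ _ => g⁻¹ * σ)
    (fun σ hσ => mul_mem_permsOn hg hσ) (fun σ hσ => mul_mem_permsOn (inv_mem_permsOn hg) hσ)
    (fun σ _ => by simp) (fun σ _ => by simp) (fun σ _ => ?_)
  rw [MonoidAlgebra.single_mul_single, map_mul]

theorem twistedSum_mul_single (ε : Perm α →* ℚ) {s : Finset α} {g : Perm α}
    (hg : g ∈ permsOn s) :
    twistedSum ε s * MonoidAlgebra.single g (ε g) = twistedSum ε s := by
  rw [twistedSum, Finset.sum_mul]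
  refine Finset.sum_bij' (fun σ _ => σ * g) (fun σ _ => σ * g⁻¹)
    (fun σ hσ => mul_mem_permsOn hσ hg) (fun σ hσ => mul_mem_permsOn hσ (inv_mem_permsOn hg))
    (fun σ _ => by simp) (fun σ _ => by simp) (fun σ _ => ?_)
  rw [MonoidAlgebra.single_mul_single, map_mul]

theorem conj_twistedSum (ε : Perm α →* ℚ) (s : Finset α) (g : Perm α) :
    MonoidAlgebra.single g 1 * twistedSum ε s * MonoidAlgebra.single g⁻¹ 1 =
      twistedSum ε (s.map g.toEmbedding) := by
  rw [twistedSum, twistedSum, Finset.mul_sum, Finset.sum_mul]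
  refine Finset.sum_bij' (fun σ _ => g * σ * g⁻¹) (fun σ _ => g⁻¹ * σ * g) ?_ ?_
    (fun σ _ => by group) (fun σ _ => by group) (fun σ _ => ?_)
  · intro σ hσ
    rw [mem_permsOn] at *
    intro x hx
    have : g⁻¹ x ∉ s := fun h => hx (Finset.mem_map.2 ⟨_, h, by simp⟩)
    rw [Perm.mul_apply, Perm.mul_apply, hσ _ this]
    simp
  · intro σ hσ
    rw [mem_permsOn] at *
    intro x hx
    have : g x ∉ s.map g.toEmbedding := by simpa using hx
    simp [hσ _ this]
  · rw [MonoidAlgebra.single_mul_single, MonoidAlgebra.single_mul_single, map_conj_eq]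
    simp

/-- Coset decomposition: a permutation `σ` on `insert o s` is uniquely `π (o x)` with `π` fixing
`o`, where `x = σ⁻¹ o`. -/
theorem twistedSum_insert (ε : Perm α →* ℚ) {s : Finset α} {o : α} (ho : o ∉ s) :
    twistedSum ε (insert o s) =
      twistedSum ε s * ∑ x ∈ insert o s, MonoidAlgebra.single (swap o x) (ε (swap o x)) := by
  rw [twistedSum, twistedSum, Finset.sum_mul_sum, ← Finset.sum_product']
  refine Finset.sum_bij' (fun σ _ => (σ * swap o (σ⁻¹ o), σ⁻¹ o)) (fun p _ => p.1 * swap o p.2)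
    ?_ ?_ ?_ ?_ ?_
  · intro σ hσ
    have hmem : σ⁻¹ o ∈ insert o s :=
      apply_mem_of_mem_permsOn (inv_mem_permsOn hσ) (Finset.mem_insert_self _ _)
    refine Finset.mem_product.2 ⟨?_, hmem⟩
    have h2 := mul_mem_permsOn hσ (swap_mem_permsOn (Finset.mem_insert_self o s) hmem)
    rw [mem_permsOn] at h2 ⊢
    intro x hx
    by_cases hxo : x = o
    · simp [hxo]
    · exact h2 x (by simp [hxo, hx])
  · intro p hp
    obtain ⟨h1, h2⟩ := Finset.mem_product.1 hp
    exact mul_mem_permsOn (permsOn_mono (Finset.subset_insert _ _) h1)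
      (swap_mem_permsOn (Finset.mem_insert_self o s) h2)
  · intro σ _
    simp [mul_assoc]
  · rintro ⟨π, x⟩ hp
    obtain ⟨h1, h2⟩ := Finset.mem_product.1 hp
    have h3 : π⁻¹ o = o := mem_permsOn.1 (inv_mem_permsOn h1) o ho
    have h4 : (π * swap o x)⁻¹ o = x := by
      rw [mul_inv_rev, Perm.mul_apply, h3, swap_inv, swap_apply_left]
    simp only
    rw [h4]
    simp [mul_assoc]
  · intro σ _
    simp only
    rw [MonoidAlgebra.single_mul_single, ← map_mul, mul_assoc, swap_mul_self, mul_one]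

theorem commute_twistedSum (ε ε' : Perm α →* ℚ) {s t : Finset α} (h : Disjoint s t) :
    Commute (twistedSum ε s) (twistedSum ε' t) := by
  refine Commute.sum_left _ _ _ fun σ hσ => Commute.sum_right _ _ _ fun τ hτ => ?_
  rw [commute_iff_eq, MonoidAlgebra.single_mul_single, MonoidAlgebra.single_mul_single,
    (commute_of_mem_permsOn h hσ hτ).eq, mul_comm]

/-- The sign of a permutation as a rational number. -/
def signHom : Perm α →* ℚ :=
  ((Int.castRingHom ℚ : ℤ →* ℚ).comp (Units.coeHom ℤ)).comp Perm.sign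

theorem signHom_apply (σ : Perm α) : signHom σ = ((Perm.sign σ : ℤ) : ℚ) := rfl

/-- If a transposition multiplies `u` and (after moving it past `g`) `v` by opposite non-zero
scalars, then `u g v = 0`. -/
theorem mul_single_mul_eq_zero {α : Type*} [DecidableEq α]
    {u v : MonoidAlgebra ℚ (Perm α)} {g : Perm α} {x y : α} {e : ℚ} (he : e ≠ 0) (hu : u * MonoidAlgebra.single (swap (g x) (g y)) 1 = e • u)
    (hv : MonoidAlgebra.single (swap x y) 1 * v = -(e • v)) :
    u * MonoidAlgebra.single g 1 * v = 0 := by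
  have h4 : (MonoidAlgebra.single (swap (g x) (g y)) 1 * MonoidAlgebra.single g 1 :
      MonoidAlgebra ℚ (Perm α)) = MonoidAlgebra.single g 1 * MonoidAlgebra.single (swap x y) 1 := by
    rw [MonoidAlgebra.single_mul_single, MonoidAlgebra.single_mul_single, mul_swap_eq_swap_mul]
  have h5 : e • (u * MonoidAlgebra.single g 1 * v) = -(e • (u * MonoidAlgebra.single g 1 * v)) := by
    calc e • (u * MonoidAlgebra.single g 1 * v)
        = u * MonoidAlgebra.single (swap (g x) (g y)) 1 * MonoidAlgebra.single g 1 * v := by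
          rw [hu, smul_mul_assoc, smul_mul_assoc]
      _ = u * MonoidAlgebra.single g 1 * (MonoidAlgebra.single (swap x y) 1 * v) := by
          rw [mul_assoc u, h4]
          simp only [mul_assoc]
      _ = _ := by rw [hv, mul_neg, mul_smul_comm]
  have h6 : (2 * e) • (u * MonoidAlgebra.single g 1 * v) = 0 := by
    rw [mul_smul, two_smul]
    nth_rewrite 1 [h5]
    exact neg_add_cancel _
  exact (smul_eq_zero.1 h6).resolve_left (mul_ne_zero two_ne_zero he)

theorem signHom_swap {x y : α} (hxy : x ≠ y) : signHom (swap x y) = -1 := by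
  simp [signHom_apply, Perm.sign_swap hxy]

theorem single_swap_mul_twistedSum_signHom {s : Finset α} {x y : α} (hxy : x ≠ y) (hx : x ∈ s)
    (hy : y ∈ s) : MonoidAlgebra.single (swap x y) 1 * twistedSum signHom s =
      -twistedSum signHom s := by
  have h := single_mul_twistedSum signHom (swap_mem_permsOn hx hy)
  rw [signHom_swap hxy, MonoidAlgebra.single_neg, neg_mul] at h
  exact neg_eq_iff_eq_neg.1 h

theorem twistedSum_signHom_mul_single_swap {s : Finset α} {x y : α} (hxy : x ≠ y) (hx : x ∈ s)
    (hy : y ∈ s) : twistedSum signHom s * MonoidAlgebra.single (swap x y) 1 =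
      -twistedSum signHom s := by
  have h := twistedSum_mul_single signHom (swap_mem_permsOn hx hy)
  rw [signHom_swap hxy, MonoidAlgebra.single_neg, mul_neg] at h
  exact neg_eq_iff_eq_neg.1 h

theorem twistedSum_one_mul_single_swap {s : Finset α} {x y : α} (hx : x ∈ s)
    (hy : y ∈ s) : twistedSum 1 s * MonoidAlgebra.single (swap x y) 1 = twistedSum 1 s :=
  twistedSum_mul_single 1 (swap_mem_permsOn hx hy)

/-- If `g` maps two elements of `t` into `s`, then the row sum over `s` and the signed column
sum over `t` annihilate `g`. -/
theorem twistedSum_mul_single_mul_twistedSum_eq_zero {s t : Finset α} {g : Perm α} {x y : α}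
    (hxy : x ≠ y) (hx : x ∈ t) (hy : y ∈ t) (hgx : g x ∈ s) (hgy : g y ∈ s) :
    twistedSum 1 s * MonoidAlgebra.single g 1 * twistedSum signHom t = 0 :=
  mul_single_mul_eq_zero one_ne_zero
    (by rw [one_smul, twistedSum_one_mul_single_swap hgx hgy])
    (by rw [one_smul, single_swap_mul_twistedSum_signHom hxy hx hy])

/-! ### Hooks and their quasi-idempotent symmetrizers -/

/-- `s` is the row, `t` the column and `o` the corner of a hook filled with the elements
of `α`. -/
structure IsHook (s t : Finset α) (o : α) : Prop where
  union : ∀ x, x ∈ s ∨ x ∈ t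
  corner_mem_row : o ∈ s
  corner_mem_col : o ∈ t
  eq_corner : ∀ x, x ∈ s → x ∈ t → x = o

/-- The Young symmetrizer of a hook. -/
def hookSymmetrizer (s t : Finset α) : MonoidAlgebra ℚ (Perm α) :=
  twistedSum 1 s * twistedSum signHom t

theorem filter_permsOn_apply_eq {s : Finset α} (o : α) :
    {σ ∈ permsOn s | σ o = o} = permsOn (s.erase o) := by
  ext σ
  simp only [Finset.mem_filter, mem_permsOn, Finset.mem_erase]
  constructor
  · rintro ⟨h1, h2⟩ x hx
    by_cases hxo : x = o
    · rw [hxo, h2]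
    · exact h1 x fun h => hx ⟨hxo, h⟩
  · intro h
    exact ⟨fun x hx => h x fun h' => hx h'.2, h o fun h' => h'.1 rfl⟩

theorem IsHook.card_add_card {s t : Finset α} {o : α} (h : IsHook s t o) :
    s.card + t.card = Fintype.card α + 1 := by
  have h1 : s ∪ t = Finset.univ := by
    ext x
    simp [h.union x]
  have h2 : s ∩ t = {o} := by
    ext x
    simp only [Finset.mem_inter, Finset.mem_singleton]
    constructor
    · rintro ⟨h3, h4⟩
      exact h.eq_corner x h3 h4
    · rintro rfl
      exact ⟨h.corner_mem_row, h.corner_mem_col⟩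
  rw [← Finset.card_union_add_card_inter, h1, h2, Finset.card_univ, Finset.card_singleton]

/-- Row and column meet only in the corner, so once either permutation fixes it the two have
disjoint supports. -/
theorem IsHook.mul_comm_of_fixed {s t : Finset α} {o : α} (h : IsHook s t o) {p q : Perm α}
    (hp : p ∈ permsOn s) (hq : q ∈ permsOn t) (hpq : q o = o ∨ p o = o) : q * p = p * q := by
  rcases hpq with ho | ho
  · have hq' : q ∈ permsOn (t.erase o) := by
      rw [← filter_permsOn_apply_eq]
      exact Finset.mem_filter.2 ⟨hq, ho⟩
    refine (commute_of_mem_permsOn ?_ hp hq').symm.eq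
    rw [Finset.disjoint_left]
    intro x hx hx'
    rw [Finset.mem_erase] at hx'
    exact hx'.1 (h.eq_corner x hx hx'.2)
  · have hp' : p ∈ permsOn (s.erase o) := by
      rw [← filter_permsOn_apply_eq]
      exact Finset.mem_filter.2 ⟨hp, ho⟩
    refine (commute_of_mem_permsOn ?_ hp' hq).symm.eq
    rw [Finset.disjoint_left]
    intro x hx hx'
    rw [Finset.mem_erase] at hx
    exact hx.1 (h.eq_corner x hx.2 hx')

/-- If the corner is fixed by one of them, `q` and `p` commute and are absorbed by the two outer
sums. Otherwise `q p` carries the column letters `q⁻¹ o` and `o` to `o` and `p o`, both in the row,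
which forces zero. -/
theorem IsHook.row_mul_mul_col {s t : Finset α} {o : α} (h : IsHook s t o) {p q : Perm α}
    (hp : p ∈ permsOn s) (hq : q ∈ permsOn t) :
    twistedSum 1 s * MonoidAlgebra.single (q * p) (signHom q) * twistedSum signHom t =
      if q o = o ∨ p o = o then hookSymmetrizer s t else 0 := by
  split_ifs with hpq
  · rw [h.mul_comm_of_fixed hp hq hpq]
    have h1 := twistedSum_mul_single 1 hp
    have h2 := single_mul_twistedSum signHom hq
    rw [MonoidHom.one_apply] at h1
    have h3 : MonoidAlgebra.single (p * q) (signHom q) =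
        MonoidAlgebra.single p 1 * MonoidAlgebra.single q (signHom q) := by
      rw [MonoidAlgebra.single_mul_single, one_mul]
    rw [h3, ← mul_assoc, h1, mul_assoc, h2, hookSymmetrizer]
  · rw [not_or] at hpq
    have h0 : twistedSum 1 s * MonoidAlgebra.single (q * p) 1 * twistedSum signHom t = 0 := by
      have hx : q⁻¹ o ∈ t := apply_mem_of_mem_permsOn (inv_mem_permsOn hq) h.corner_mem_col
      have hxo : q⁻¹ o ≠ o := fun h' => hpq.1 (Perm.inv_eq_iff_eq.1 h').symm
      have hxs : q⁻¹ o ∉ s := fun h' => hxo (h.eq_corner _ h' hx)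
      have hps : p o ∈ s := apply_mem_of_mem_permsOn hp h.corner_mem_row
      have hpt : p o ∉ t := fun h' => hpq.2 (h.eq_corner _ hps h')
      refine twistedSum_mul_single_mul_twistedSum_eq_zero hxo hx h.corner_mem_col ?_ ?_
      · rw [Perm.mul_apply, mem_permsOn.1 hp _ hxs, Perm.inv_def, apply_symm_apply]
        exact h.corner_mem_row
      · rw [Perm.mul_apply, mem_permsOn.1 hq _ hpt]
        exact hps
    have h1 : (MonoidAlgebra.single (q * p) (signHom q) : MonoidAlgebra ℚ (Perm α)) =
        signHom q • MonoidAlgebra.single (q * p) 1 := by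
      rw [MonoidAlgebra.smul_single, smul_eq_mul, mul_one]
    rw [h1, mul_smul_comm, smul_mul_assoc, h0, smul_zero]

/-- Inclusion–exclusion: with `a + 1` row and `b + 1` column letters, `(a+1)! b! + a! (b+1)! - a! b!
= (a + b + 1) a! b!`, and `a + b + 1` is the number of letters. -/
theorem card_filter_permsOn_fixed {s t : Finset α} {o : α} (h : IsHook s t o) :
    (((permsOn t ×ˢ permsOn s).filter fun x => x.1 o = o ∨ x.2 o = o).card : ℚ) =
      Fintype.card α * ((s.card - 1).factorial * (t.card - 1).factorial) := by
  have h1 : ((permsOn t ×ˢ permsOn s).filter fun x => x.1 o = o ∨ x.2 o = o) =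
      (permsOn (t.erase o) ×ˢ permsOn s) ∪ (permsOn t ×ˢ permsOn (s.erase o)) := by
    ext ⟨q, p⟩
    simp only [← filter_permsOn_apply_eq, Finset.mem_filter, Finset.mem_product, Finset.mem_union]
    tauto
  have h2 : (permsOn (t.erase o) ×ˢ permsOn s) ∩ (permsOn t ×ˢ permsOn (s.erase o)) =
      permsOn (t.erase o) ×ˢ permsOn (s.erase o) := by
    ext ⟨q, p⟩
    simp only [← filter_permsOn_apply_eq, Finset.mem_filter, Finset.mem_product, Finset.mem_inter]
    tauto
  have h3 := Finset.card_union_add_card_inter (permsOn (t.erase o) ×ˢ permsOn s)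
    (permsOn t ×ˢ permsOn (s.erase o))
  rw [← h1, h2] at h3
  simp only [Finset.card_product, card_permsOn, Finset.card_erase_of_mem h.corner_mem_row,
    Finset.card_erase_of_mem h.corner_mem_col] at h3
  have h4 := h.card_add_card
  obtain ⟨a, ha⟩ : ∃ a, s.card = a + 1 :=
    ⟨s.card - 1, by have := Finset.card_pos.2 ⟨o, h.corner_mem_row⟩; omega⟩
  obtain ⟨b, hb⟩ : ∃ b, t.card = b + 1 :=
    ⟨t.card - 1, by have := Finset.card_pos.2 ⟨o, h.corner_mem_col⟩; omega⟩
  have h5 : Fintype.card α = a + b + 1 := by omega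
  rw [ha, hb] at h3 ⊢
  rw [h5]
  simp only [Nat.add_sub_cancel, Nat.factorial_succ] at h3 ⊢
  have h6 := congrArg (Nat.cast : ℕ → ℚ) h3
  push_cast at h6 ⊢
  linear_combination h6

theorem IsHook.hookSymmetrizer_mul_self {s t : Finset α} {o : α} (h : IsHook s t o) :
    hookSymmetrizer s t * hookSymmetrizer s t =
      (Fintype.card α * ((s.card - 1).factorial * (t.card - 1).factorial) : ℚ) •
        hookSymmetrizer s t := by
  have h1 : twistedSum signHom t * twistedSum 1 s = ∑ x ∈ permsOn t ×ˢ permsOn s,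
      MonoidAlgebra.single (x.1 * x.2) (signHom x.1) := by
    rw [twistedSum, twistedSum, Finset.sum_mul_sum, ← Finset.sum_product']
    refine Finset.sum_congr rfl fun x _ => ?_
    rw [MonoidAlgebra.single_mul_single, MonoidHom.one_apply, mul_one]
  have h2 : hookSymmetrizer s t * hookSymmetrizer s t = ∑ x ∈ permsOn t ×ˢ permsOn s,
      if x.1 o = o ∨ x.2 o = o then hookSymmetrizer s t else 0 := by
    calc _ = twistedSum 1 s * (twistedSum signHom t * twistedSum 1 s) * twistedSum signHom t := by
          simp only [hookSymmetrizer, mul_assoc]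
      _ = _ := by
          rw [h1, Finset.mul_sum, Finset.sum_mul]
          refine Finset.sum_congr rfl fun x hx => ?_
          rw [Finset.mem_product] at hx
          exact h.row_mul_mul_col hx.2 hx.1
  rw [h2, ← Finset.sum_filter, Finset.sum_const, ← card_filter_permsOn_fixed h]
  exact (Nat.cast_smul_eq_nsmul ℚ _ _).symm

end TwistedSum

/-! ### The class functions of hooks -/

section HookClass

variable {α : Type*} [Fintype α] [DecidableEq α]

theorem exists_perm_map_eq {s t : Finset α} (h : s.card = t.card) :
    ∃ g : Perm α, s.map g.toEmbedding = t := by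
  let e : {x // x ∈ s} ≃ {x // x ∈ t} := Finset.equivOfCardEq h
  refine ⟨e.extendSubtype, ?_⟩
  apply Finset.eq_of_subset_of_card_le
  · intro y hy
    obtain ⟨x, hx, rfl⟩ := Finset.mem_map.1 hy
    exact e.extendSubtype_mem x hx
  · rw [Finset.card_map, h]

theorem IsHook.row_eq {s t : Finset α} {o : α} (h : IsHook s t o) : s = (t.erase o)ᶜ := by
  ext x
  simp only [Finset.mem_compl, Finset.mem_erase, not_and_or, not_not]
  constructor
  · intro hx
    by_cases hxt : x ∈ t
    · exact Or.inl (h.eq_corner x hx hxt)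
    · exact Or.inr hxt
  · rintro (rfl | hx)
    · exact h.corner_mem_row
    · exact (h.union x).resolve_right hx

/-- Match the columns without their corners, then correct the corner by a transposition; rows
follow, being complements of these punctured columns. -/
theorem IsHook.exists_perm {s t s' t' : Finset α} {o o' : α} (h : IsHook s t o)
    (h' : IsHook s' t' o') (hc : t.card = t'.card) :
    ∃ g : Perm α, s.map g.toEmbedding = s' ∧ t.map g.toEmbedding = t' := by
  have hc' : (t.erase o).card = (t'.erase o').card := by
    rw [Finset.card_erase_of_mem h.corner_mem_col, Finset.card_erase_of_mem h'.corner_mem_col, hc]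
  obtain ⟨g, hg⟩ := exists_perm_map_eq hc'
  have ho : g o ∉ t'.erase o' := by
    rw [← hg]
    simp
  have h1 : (t.erase o).map (swap (g o) o' * g).toEmbedding = t'.erase o' := by
    apply Finset.eq_of_subset_of_card_le
    · intro y hy
      obtain ⟨x, hx, rfl⟩ := Finset.mem_map.1 hy
      have hgx : g x ∈ t'.erase o' := by
        rw [← hg]
        exact Finset.mem_map_of_mem _ hx
      have : (swap (g o) o' * g) x = g x := by
        rw [Perm.mul_apply]
        apply swap_apply_of_ne_of_ne
        · rintro h2
          exact ho (h2 ▸ hgx)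
        · exact (Finset.mem_erase.1 hgx).1
      rw [coe_toEmbedding, this]
      exact hgx
    · rw [Finset.card_map, hc']
  refine ⟨swap (g o) o' * g, ?_, ?_⟩
  · rw [h.row_eq, h'.row_eq, ← h1]
    ext x
    simp only [Finset.mem_map_equiv, Finset.mem_compl]
  · rw [← Finset.insert_erase h.corner_mem_col, Finset.map_insert, h1]
    have : (swap (g o) o' * g).toEmbedding o = o' := by simp
    rw [this, Finset.insert_erase h'.corner_mem_col]

theorem conj_hookSymmetrizer (s t : Finset α) (g : Perm α) :
    MonoidAlgebra.single g 1 * hookSymmetrizer s t * MonoidAlgebra.single g⁻¹ 1 =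
      hookSymmetrizer (s.map g.toEmbedding) (t.map g.toEmbedding) := by
  have h1 : (MonoidAlgebra.single g⁻¹ 1 * MonoidAlgebra.single g 1 : MonoidAlgebra ℚ (Perm α)) =
      1 := by
    rw [MonoidAlgebra.single_mul_single, inv_mul_cancel, mul_one, MonoidAlgebra.one_def]
  rw [hookSymmetrizer, hookSymmetrizer, ← conj_twistedSum, ← conj_twistedSum]
  simp only [mul_assoc]
  rw [← mul_assoc (MonoidAlgebra.single g⁻¹ 1) (MonoidAlgebra.single g 1), h1, one_mul]

theorem IsHook.classSum_eq {s t s' t' : Finset α} {o o' : α} (h : IsHook s t o)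
    (h' : IsHook s' t' o') (hc : t.card = t'.card) :
    classSum (hookSymmetrizer s t) = classSum (hookSymmetrizer s' t') := by
  obtain ⟨g, rfl, rfl⟩ := h.exists_perm h' hc
  rw [← conj_hookSymmetrizer, classSum_conj]

theorem isHook_compl_insert {z : Finset α} {o : α} (ho : o ∉ z) : IsHook zᶜ (insert o z) o where
  union x := by
    by_cases hx : x ∈ z <;> simp [hx]
  corner_mem_row := by simpa using ho
  corner_mem_col := Finset.mem_insert_self _ _
  eq_corner x h1 h2 := by
    rw [Finset.mem_compl] at h1
    exact (Finset.mem_insert.1 h2).resolve_right h1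

theorem isHook_insert_compl {z : Finset α} {o : α} (ho : o ∈ z) : IsHook (insert o zᶜ) z o where
  union x := by
    by_cases hx : x ∈ z <;> simp [hx]
  corner_mem_row := Finset.mem_insert_self _ _
  corner_mem_col := ho
  eq_corner x h1 h2 := by
    refine (Finset.mem_insert.1 h1).resolve_right ?_
    simpa using h2

theorem classSum_hook_compl_insert {z : Finset α} {o : α} (ho : o ∉ z) :
    classSum (hookSymmetrizer zᶜ (insert o z)) =
      classSum (twistedSum 1 zᶜ * twistedSum signHom z) -
        ∑ x ∈ z, classSum (twistedSum 1 zᶜ * twistedSum signHom z *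
          MonoidAlgebra.single (swap o x) 1) := by
  rw [hookSymmetrizer, twistedSum_insert _ ho, Finset.sum_insert ho, ← mul_assoc, mul_add, map_add,
    swap_self, ← Perm.one_def, map_one, ← MonoidAlgebra.one_def, mul_one, Finset.mul_sum, map_sum,
    sub_eq_add_neg, ← Finset.sum_neg_distrib]
  congr 1
  refine Finset.sum_congr rfl fun x hx => ?_
  have hox : o ≠ x := fun h => ho (h ▸ hx)
  rw [signHom_apply, Perm.sign_swap hox]
  simp only [Units.val_neg, Units.val_one, Int.cast_neg, Int.cast_one, MonoidAlgebra.single_neg,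
    mul_neg, map_neg]

/-- Enlarging the row modifies the left factor; the trace property of `classSum` brings the
transpositions to the right, in the same form as when the column is enlarged. -/
theorem classSum_hook_insert_compl {z : Finset α} {x : α} (hx : x ∈ z) :
    classSum (hookSymmetrizer (insert x zᶜ) z) =
      classSum (twistedSum 1 zᶜ * twistedSum signHom z) +
        ∑ o ∈ zᶜ, classSum (twistedSum 1 zᶜ * twistedSum signHom z *
          MonoidAlgebra.single (swap o x) 1) := by
  have hx' : x ∉ zᶜ := by simpa using hx
  rw [hookSymmetrizer, twistedSum_insert _ hx', classSum_mul_comm, ← mul_assoc,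
    (commute_twistedSum signHom 1 (disjoint_compl_right : Disjoint z zᶜ)).eq,
    Finset.sum_insert hx', mul_add, map_add, swap_self, ← Perm.one_def, map_one,
    ← MonoidAlgebra.one_def, mul_one, Finset.mul_sum, map_sum]
  congr 1
  refine Finset.sum_congr rfl fun o _ => ?_
  rw [swap_comm, MonoidHom.one_apply]

/-- Each transposition between `z` and its complement occurs once with each sign: minus from
extending the column, plus from extending the row. Only one untwisted term per letter survives. -/
theorem sum_classSum_hook (z : Finset α) :
    ∑ o ∈ zᶜ, classSum (hookSymmetrizer zᶜ (insert o z)) +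
        ∑ x ∈ z, classSum (hookSymmetrizer (insert x zᶜ) z) =
      (Fintype.card α : ℚ) • classSum (twistedSum 1 zᶜ * twistedSum signHom z) := by
  rw [Finset.sum_congr rfl fun o ho => classSum_hook_compl_insert (Finset.mem_compl.1 ho),
    Finset.sum_congr rfl fun x hx => classSum_hook_insert_compl hx, Finset.sum_sub_distrib,
    Finset.sum_add_distrib, Finset.sum_const, Finset.sum_const, Finset.sum_comm (s := z),
    sub_add_add_cancel, ← add_nsmul, Finset.card_compl_add_card, Nat.cast_smul_eq_nsmul]

open Classical in
/-- The class function of the hook with `k + 1` rows, normalised so as to be an irreducible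
character; zero if there is no such hook. -/
def hookChar (k : ℕ) (σ : Perm α) : ℚ :=
  if h : ∃ p : Finset α × Finset α × α, IsHook p.1 p.2.1 p.2.2 ∧ p.2.1.card = k + 1 then
    classSum (hookSymmetrizer h.choose.1 h.choose.2.1) σ /
      (Fintype.card α * ((Fintype.card α - 1 - k).factorial * k.factorial))
  else 0

theorem IsHook.card_row {s t : Finset α} {o : α} (h : IsHook s t o) {k : ℕ}
    (hk : t.card = k + 1) : s.card - 1 = Fintype.card α - 1 - k := by
  have := h.card_add_card
  omega

theorem hookChar_eq {s t : Finset α} {o : α} (h : IsHook s t o) {k : ℕ} (hk : t.card = k + 1)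
    (σ : Perm α) :
    hookChar k σ = classSum (hookSymmetrizer s t) σ /
      (Fintype.card α * ((Fintype.card α - 1 - k).factorial * k.factorial)) := by
  have hex : ∃ p : Finset α × Finset α × α, IsHook p.1 p.2.1 p.2.2 ∧ p.2.1.card = k + 1 :=
    ⟨(s, t, o), h, hk⟩
  rw [hookChar, dif_pos hex, hex.choose_spec.1.classSum_eq h (hex.choose_spec.2.trans hk.symm)]

theorem hookChar_eq_zero {k : ℕ} (hk : Fintype.card α ≤ k) (σ : Perm α) : hookChar k σ = 0 := by
  rw [hookChar, dif_neg]
  rintro ⟨p, h, hp⟩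
  have h1 := h.card_add_card
  have h2 := Finset.card_pos.2 ⟨_, h.corner_mem_row⟩
  omega

theorem IsHook.classSum_eq_hookChar {s t : Finset α} {o : α} (h : IsHook s t o) {k : ℕ}
    (hk : t.card = k + 1) (σ : Perm α) :
    classSum (hookSymmetrizer s t) σ =
      (Fintype.card α * ((Fintype.card α - 1 - k).factorial * k.factorial)) * hookChar k σ := by
  have : (Fintype.card α : ℚ) ≠ 0 := by
    have := Fintype.card_pos_iff.2 ⟨o⟩
    positivity
  rw [hookChar_eq h hk]
  field_simp

/-- The sum of two consecutive hook class functions is an induced class function. -/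
theorem hookChar_succ_add (z : Finset α) (σ : Perm α) (k : ℕ) (hz : z.card = k + 1) :
    ((Fintype.card α - (k + 1)).factorial * (k + 1).factorial : ℚ) *
      (hookChar (k + 1) σ + hookChar k σ) =
    classSum (twistedSum 1 zᶜ * twistedSum signHom z) σ := by
  have h := congrFun (sum_classSum_hook z) σ
  have hle : k + 1 ≤ Fintype.card α := hz ▸ Finset.card_le_univ z
  have hd : (Fintype.card α : ℚ) ≠ 0 := by
    have : 0 < Fintype.card α := by omega
    positivity
  rw [Pi.add_apply, Finset.sum_apply, Finset.sum_apply, Pi.smul_apply, smul_eq_mul,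
    Finset.sum_congr rfl fun o ho => (isHook_compl_insert
      (Finset.mem_compl.1 ho)).classSum_eq_hookChar (k := k + 1)
      (by rw [Finset.card_insert_of_notMem (Finset.mem_compl.1 ho), hz]) σ,
    Finset.sum_congr rfl fun x hx => (isHook_insert_compl hx).classSum_eq_hookChar (k := k) hz σ,
    Finset.sum_const, Finset.sum_const, hz, Finset.card_compl, hz, nsmul_eq_mul, nsmul_eq_mul] at h
  apply mul_left_cancel₀ hd
  rw [← h]
  obtain ⟨m, hm⟩ := Nat.exists_eq_add_of_le hle
  rw [hm]
  have e1 : k + 1 + m - (k + 1) = m := by omega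
  have e2 : k + 1 + m - 1 - k = m := by omega
  rw [e1, e2]
  -- Here `m` is the number of letters outside `z`. If it is zero, no hook has its corner there and
  -- `hookChar (k + 1)` vanishes; otherwise each family contributes the common factor `(k + 1)! m!`.
  rcases m with _ | m
  · rw [hookChar_eq_zero (k := k + 1) (by omega)]
    push_cast [Nat.factorial_succ]
    ring
  · have e3 : k + 1 + (m + 1) - 1 - (k + 1) = m := by omega
    rw [e3]
    push_cast [Nat.factorial_succ]
    ring

theorem hookChar_zero [Nonempty α] (σ : Perm α) :
    ((Fintype.card α).factorial : ℚ) * hookChar 0 σ =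
      classSum (twistedSum 1 (∅ : Finset α)ᶜ * twistedSum signHom ∅) σ := by
  obtain ⟨o⟩ := ‹Nonempty α›
  have ho : o ∉ (∅ : Finset α) := Finset.notMem_empty o
  have h := congrFun (classSum_hook_compl_insert ho) σ
  rw [(isHook_compl_insert ho).classSum_eq_hookChar (k := 0) (by simp)] at h
  rw [Finset.sum_empty, sub_zero] at h
  rw [← h, Nat.sub_zero, ← Nat.mul_factorial_pred (Fintype.card_ne_zero (α := α))]
  push_cast [Nat.factorial_zero]
  ring

end HookClass

/-! ### The polynomial `det (1 + q P_σ)` -/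

section CycleDet

variable {α : Type*} [Fintype α] [DecidableEq α]

/-- The determinant `det (1 + q P_σ)`, where `P_σ` is the permutation matrix of `σ`. -/
def cycleDet (σ : Perm α) : Polynomial ℚ :=
  Matrix.det (1 + (Polynomial.X : Polynomial ℚ) • σ.permMatrix (Polynomial ℚ))

theorem cycleDet_eq_sum (σ : Perm α) :
    cycleDet σ = ∑ π : Perm α, Polynomial.C (signHom π) *
      ∏ i, (Polynomial.X * (if π i = σ i then 1 else 0) + if π i = i then 1 else 0) := by
  rw [cycleDet, ← Matrix.det_transpose, Matrix.det_apply]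
  refine Finset.sum_congr rfl fun π _ => ?_
  have h1 : (Perm.sign π : ℤˣ) • (∏ i, (1 + (Polynomial.X : Polynomial ℚ) •
      σ.permMatrix (Polynomial ℚ)).transpose (π i) i) = Polynomial.C (signHom π) *
      (∏ i, (1 + (Polynomial.X : Polynomial ℚ) •
      σ.permMatrix (Polynomial ℚ)).transpose (π i) i) := by
    rw [signHom_apply, Units.smul_def, zsmul_eq_mul]
    simp
  rw [h1]
  congr 1
  refine Finset.prod_congr rfl fun i _ => ?_
  simp only [Matrix.transpose_apply, Matrix.add_apply, Matrix.smul_apply, PEquiv.toMatrix_apply,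
    Matrix.one_apply, smul_eq_mul, toPEquiv_apply, Option.mem_def, Option.some.injEq]
  rw [add_comm]
  simp only [eq_comm]

theorem cycleDet_one : cycleDet (1 : Perm α) = (1 + Polynomial.X) ^ Fintype.card α := by
  rw [cycleDet, Matrix.permMatrix_one]
  have : (1 + (Polynomial.X : Polynomial ℚ) • (1 : Matrix α α (Polynomial ℚ))) =
      (1 + (Polynomial.X : Polynomial ℚ)) • (1 : Matrix α α (Polynomial ℚ)) := by
    rw [add_smul, one_smul]
  rw [this, Matrix.det_smul, Matrix.det_one, mul_one]

theorem permMatrix_mul_of_disjoint {α : Type*} [DecidableEq α] {σ τ : Perm α} (h : Perm.Disjoint σ τ) :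
    (σ * τ).permMatrix (Polynomial ℚ) =
      σ.permMatrix (Polynomial ℚ) + τ.permMatrix (Polynomial ℚ) - 1 := by
  ext1 i j
  simp only [Matrix.sub_apply, Matrix.add_apply, PEquiv.toMatrix_apply, toPEquiv_apply,
    Option.mem_def, Option.some.injEq, Perm.mul_apply, Matrix.one_apply]
  rcases h i with hi | hi
  · have hσ : σ (τ i) = τ i := by
      rcases h (τ i) with h' | h'
      · exact h'
      · rw [τ.injective h', hi]
    rw [hσ, hi]
    ring
  · rw [hi]
    ring

/-- Disjointness gives `P_τ P_σ = P_σ + P_τ - 1`, hence `(1 + q P_τ)(1 + q P_σ) = (1 + q)(1 + q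
P_{στ})`. -/
theorem cycleDet_mul_of_disjoint {σ τ : Perm α} (h : Perm.Disjoint σ τ) :
    (1 + Polynomial.X) ^ Fintype.card α * cycleDet (σ * τ) = cycleDet σ * cycleDet τ := by
  have h1 := permMatrix_mul_of_disjoint h
  have h2 : τ.permMatrix (Polynomial ℚ) * σ.permMatrix (Polynomial ℚ) =
      σ.permMatrix (Polynomial ℚ) + τ.permMatrix (Polynomial ℚ) - 1 := by
    rw [← h1, Matrix.permMatrix_mul]
  rw [mul_comm (cycleDet σ), cycleDet, cycleDet, cycleDet, ← Matrix.det_mul, ← Matrix.det_smul, h1]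
  congr 1
  simp only [mul_add, add_mul, one_mul, mul_one, Matrix.smul_mul, Matrix.mul_smul, h2]
  module

theorem prod_agree_eq_zero {σ π : Perm α} {i : α} (h1 : π i ≠ σ i) (h2 : π i ≠ i) :
    ∏ i, ((Polynomial.X : Polynomial ℚ) * (if π i = σ i then 1 else 0) +
      if π i = i then 1 else 0) = 0 :=
  Finset.prod_eq_zero (Finset.mem_univ i) (by simp [h1, h2])

/-- A permutation which agrees with a cycle or with the identity at each point is one of them. -/
theorem eq_one_or_eq_of_isCycle {σ π : Perm α} (hσ : σ.IsCycle)
    (h : ∀ i, π i = σ i ∨ π i = i) : π = 1 ∨ π = σ := by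
  by_cases hex : ∃ i, π i ≠ i
  · right
    obtain ⟨i, hi⟩ := hex
    have hstep : ∀ j, π j = σ j → σ j ≠ j → π (σ j) = σ (σ j) := by
      intro j hj hj'
      rcases h (σ j) with h1 | h1
      · exact h1
      · exact absurd (π.injective (h1.trans hj.symm)) hj'
    have hi1 : π i = σ i := (h i).resolve_right hi
    have hi2 : σ i ≠ i := hi1 ▸ hi
    have hpow : ∀ n : ℕ, π ((σ ^ n) i) = σ ((σ ^ n) i) := by
      intro n
      induction n with
      | zero => simpa using hi1
      | succ n ih =>
        rw [pow_succ', Perm.mul_apply]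
        refine hstep _ ih ?_
        intro h2
        apply hi2
        have h3 : (σ ^ n) (σ i) = (σ ^ n) i := by
          rw [← Perm.mul_apply, ← pow_succ, pow_succ', Perm.mul_apply, h2]
        exact (σ ^ n).injective h3
    ext j
    by_cases hj : σ j = j
    · rcases h j with h1 | h1
      · rw [h1]
      · rw [h1, hj]
    · obtain ⟨n, hn⟩ := hσ.exists_pow_eq hi2 hj
      rw [← hn, hpow]
  · left
    push Not at hex
    ext j
    simp [hex j]

/-- In the Leibniz expansion only permutations that agree pointwise with `σ` or the identity
survive; for a cycle these are just `1` and `σ`. -/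
theorem cycleDet_of_isCycle {σ : Perm α} (hσ : σ.IsCycle) :
    cycleDet σ = (1 + Polynomial.X) ^ (Fintype.card α - σ.support.card) *
      (1 - (-Polynomial.X) ^ σ.support.card) := by
  have hne : σ ≠ 1 := hσ.ne_one
  have h0 : ∀ π ∈ Finset.univ, π ∉ ({1, σ} : Finset (Perm α)) → Polynomial.C (signHom π) *
      ∏ i, ((Polynomial.X : Polynomial ℚ) * (if π i = σ i then 1 else 0) +
        if π i = i then 1 else 0) = 0 := by
    intro π _ hπ
    have h1 : ∃ i, π i ≠ σ i ∧ π i ≠ i := by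
      by_contra hcon
      push Not at hcon
      apply hπ
      rw [Finset.mem_insert, Finset.mem_singleton]
      exact eq_one_or_eq_of_isCycle hσ fun i => or_iff_not_imp_left.2 (hcon i)
    obtain ⟨i, h1, h2⟩ := h1
    rw [prod_agree_eq_zero h1 h2, mul_zero]
  have hsplit : ∀ f : α → Polynomial ℚ, ∏ i, f i =
      (∏ i ∈ σ.support, f i) * ∏ i ∈ σ.supportᶜ, f i :=
    fun f => (Finset.prod_mul_prod_compl _ _).symm
  rw [cycleDet_eq_sum, ← Finset.sum_subset (Finset.subset_univ {1, σ}) h0,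
    Finset.sum_pair hne.symm, hsplit, hsplit]
  have e1 : ∏ i ∈ σ.support, ((Polynomial.X : Polynomial ℚ) *
      (if (1 : Perm α) i = σ i then 1 else 0) + if (1 : Perm α) i = i then 1 else 0) = 1 := by
    refine Finset.prod_eq_one fun i hi => ?_
    have : i ≠ σ i := (Perm.mem_support.1 hi).symm
    simp [this]
  have e2 : ∏ i ∈ σ.support, ((Polynomial.X : Polynomial ℚ) *
      (if σ i = σ i then 1 else 0) + if σ i = i then 1 else 0) =
      Polynomial.X ^ σ.support.card := by
    rw [← Finset.prod_const]
    refine Finset.prod_congr rfl fun i hi => ?_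
    simp [Perm.mem_support.1 hi]
  have e3 : ∏ i ∈ σ.supportᶜ, ((Polynomial.X : Polynomial ℚ) *
      (if (1 : Perm α) i = σ i then 1 else 0) + if (1 : Perm α) i = i then 1 else 0) =
      (1 + Polynomial.X) ^ (Fintype.card α - σ.support.card) := by
    rw [← Finset.card_compl, ← Finset.prod_const]
    refine Finset.prod_congr rfl fun i hi => ?_
    have : σ i = i := by simpa using hi
    simp [this, add_comm]
  have e4 : ∏ i ∈ σ.supportᶜ, ((Polynomial.X : Polynomial ℚ) *
      (if σ i = σ i then 1 else 0) + if σ i = i then 1 else 0) =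
      (1 + Polynomial.X) ^ (Fintype.card α - σ.support.card) := by
    rw [← Finset.card_compl, ← Finset.prod_const]
    refine Finset.prod_congr rfl fun i hi => ?_
    have : σ i = i := by simpa using hi
    simp [this, add_comm]
  rw [e1, e2, e3, e4, map_one, signHom_apply, hσ.sign, neg_pow (Polynomial.X : Polynomial ℚ)]
  push_cast
  simp only [map_neg, map_one, map_pow]
  ring

theorem cycleDet_eq_prod_cycleType (σ : Perm α) :
    cycleDet σ = (1 + Polynomial.X) ^ (Fintype.card α - σ.support.card) *
      (σ.cycleType.map fun b => 1 - (-Polynomial.X) ^ b).prod := by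
  induction σ using Perm.cycle_induction_on with
  | base_one => simp [cycleDet_one]
  | base_cycles σ hσ => rw [cycleDet_of_isCycle hσ, hσ.cycleType, Multiset.map_singleton,
      Multiset.prod_singleton]
  | induction_disjoint σ τ h _ h1 h2 =>
    have hne : (1 + Polynomial.X : Polynomial ℚ) ^ Fintype.card α ≠ 0 := by
      apply pow_ne_zero
      rw [add_comm]
      exact Polynomial.X_add_C_ne_zero 1
    apply mul_left_cancel₀ hne
    have hle : σ.support.card + τ.support.card ≤ Fintype.card α := by
      rw [← h.card_support_mul]
      exact Finset.card_le_univ _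
    rw [cycleDet_mul_of_disjoint h, h1, h2, h.cycleType_mul, Multiset.map_add, Multiset.prod_add,
      h.card_support_mul]
    have e : (1 + Polynomial.X : Polynomial ℚ) ^ (Fintype.card α - σ.support.card) *
        (1 + Polynomial.X) ^ (Fintype.card α - τ.support.card) = (1 + Polynomial.X) ^
        Fintype.card α * (1 + Polynomial.X) ^
          (Fintype.card α - (σ.support.card + τ.support.card)) := by
      rw [← pow_add, ← pow_add]
      congr 1
      omega
    linear_combination (σ.cycleType.map fun b => 1 - (-Polynomial.X : Polynomial ℚ) ^ b).prod *
      (τ.cycleType.map fun b => 1 - (-Polynomial.X : Polynomial ℚ) ^ b).prod * e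

/-- `det (1 + q P_σ)` is the product of `1 - (-q)^b` over the cycle lengths `b` of `σ`. -/
theorem cycleDet_eq_prod (σ : Perm α) :
    cycleDet σ = (σ.partition.parts.map fun b => 1 - (-Polynomial.X) ^ b).prod := by
  rw [cycleDet_eq_prod_cycleType, Perm.parts_partition, Multiset.map_add, Multiset.prod_add,
    Multiset.map_replicate, Multiset.prod_replicate, pow_one, sub_neg_eq_add, mul_comm]

/-! ### Coefficients of the determinant as induced characters -/

/-- The signed number of permutations moving only elements of `s` and agreeing with `σ` there. -/
def restrictedSign (σ : Perm α) (s : Finset α) : ℚ :=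
  ∑ π ∈ permsOn s with ∀ x ∈ s, π x = σ x, signHom π

/-- Expand every factor of the Leibniz product: `s` records the indices at which the term carrying
`X` is chosen. -/
theorem coeff_cycleDet (σ : Perm α) (k : ℕ) :
    (cycleDet σ).coeff k = ∑ s ∈ Finset.powersetCard k Finset.univ, restrictedSign σ s := by
  have h1 : cycleDet σ = ∑ s : Finset α,
      Polynomial.C (restrictedSign σ s) * Polynomial.X ^ s.card := by
    rw [cycleDet_eq_sum]
    simp_rw [Finset.prod_add, Finset.mul_sum]
    rw [Finset.sum_comm, Finset.powerset_univ]
    refine Finset.sum_congr rfl fun s _ => ?_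
    rw [restrictedSign, permsOn, Finset.filter_filter, map_sum, Finset.sum_mul, Finset.sum_filter]
    refine Finset.sum_congr rfl fun π _ => ?_
    rw [Finset.prod_mul_distrib, Finset.prod_const]
    split_ifs with h
    · rw [Finset.prod_eq_one (s := s) fun i hi => if_pos (h.2 i hi),
        Finset.prod_eq_one (s := Finset.univ \ s) fun i hi => if_pos (h.1 i (by simpa using hi)),
        mul_one, mul_one]
    · rw [not_and_or] at h
      push Not at h
      rcases h with ⟨i, hi, h⟩ | ⟨i, hi, h⟩
      · rw [Finset.prod_eq_zero (s := Finset.univ \ s) (i := i) (by simpa using hi) (if_neg h),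
          mul_zero, mul_zero]
      · rw [Finset.prod_eq_zero (s := s) (i := i) hi (if_neg h), mul_zero, zero_mul, mul_zero]
  rw [h1, Polynomial.finsetSum_coeff]
  simp_rw [Polynomial.coeff_C_mul_X_pow]
  rw [← Finset.sum_filter]
  refine Finset.sum_congr ?_ fun _ _ => rfl
  ext s
  simp [Finset.mem_powersetCard, eq_comm]

theorem card_perm_map_eq {s t : Finset α} (h : s.card = t.card) :
    Finset.card {τ : Perm α | s.map τ.toEmbedding = t} =
      Finset.card {τ : Perm α | s.map τ.toEmbedding = s} := by
  obtain ⟨g, hg⟩ := exists_perm_map_eq h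
  have hmul : ∀ (a b : Perm α) (u : Finset α), u.map (a * b).toEmbedding =
      (u.map b.toEmbedding).map a.toEmbedding := by
    intro a b u
    rw [Finset.map_map]
    rfl
  refine Finset.card_bij' (fun τ _ => g⁻¹ * τ) (fun τ _ => g * τ) ?_ ?_ ?_ ?_
  · intro τ hτ
    simp only [Finset.mem_filter, Finset.mem_univ, true_and] at hτ ⊢
    rw [hmul, hτ, ← hg, ← hmul]
    simp [Perm.one_def]
  · intro τ hτ
    simp only [Finset.mem_filter, Finset.mem_univ, true_and] at hτ ⊢
    rw [hmul, hτ, hg]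
  · intro τ _
    simp
  · intro τ _
    simp

theorem sum_perm_map (f : Finset α → ℚ) (z : Finset α) :
    ∑ τ : Perm α, f (z.map τ.toEmbedding) =
      ((Fintype.card α - z.card).factorial * z.card.factorial : ℚ) *
        ∑ s ∈ Finset.powersetCard z.card Finset.univ, f s := by
  have key : ∀ f : Finset α → ℚ, ∑ τ : Perm α, f (z.map τ.toEmbedding) =
      (Finset.card {τ : Perm α | z.map τ.toEmbedding = z} : ℚ) *
        ∑ s ∈ Finset.powersetCard z.card Finset.univ, f s := by
    intro f
    rw [← Finset.sum_fiberwise_of_maps_to (s := Finset.univ)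
      (t := Finset.powersetCard z.card Finset.univ)
      (g := fun τ : Perm α => z.map τ.toEmbedding) (by simp [Finset.mem_powersetCard]),
      Finset.mul_sum]
    refine Finset.sum_congr rfl fun s hs => ?_
    rw [Finset.sum_congr rfl (g := fun _ => f s)
      (fun τ hτ => by rw [(Finset.mem_filter.1 hτ).2]), Finset.sum_const, nsmul_eq_mul,
      card_perm_map_eq (Finset.mem_powersetCard.1 hs).2.symm]
  -- The constant function determines the order of the stabilizer of `z`.
  have h1 := key fun _ => 1
  rw [Finset.sum_const, Finset.sum_const, Finset.card_powersetCard, Finset.card_univ,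
    Finset.card_univ, Fintype.card_perm, nsmul_eq_mul, nsmul_eq_mul, mul_one, mul_one,
    ← Nat.choose_mul_factorial_mul_factorial (Finset.card_le_univ z)] at h1
  have h2 : ((Fintype.card α).choose z.card : ℚ) ≠ 0 := by
    exact_mod_cast (Nat.choose_pos (Finset.card_le_univ z)).ne'
  rw [key f]
  congr 1
  apply mul_right_cancel₀ h2
  rw [← h1]
  push_cast
  ring

/-- Writing `g = q p` with `q` on `z` forces `p = q⁻¹ g`, which fixes `z` pointwise exactly when `q`
and `g` agree on `z`. -/
theorem coeff_twistedSum_mul_twistedSum (z : Finset α) (g : Perm α) :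
    (twistedSum 1 zᶜ * twistedSum signHom z).coeff g = restrictedSign g z := by
  rw [← (commute_twistedSum signHom 1 (disjoint_compl_right : Disjoint z zᶜ)).eq, twistedSum,
    twistedSum, Finset.sum_mul, MonoidAlgebra.coeff_sum, Finsupp.finsetSum_apply, restrictedSign,
    Finset.sum_filter]
  refine Finset.sum_congr rfl fun q _ => ?_
  rw [Finset.mul_sum, MonoidAlgebra.coeff_sum, Finsupp.finsetSum_apply]
  have h1 : ∀ p ∈ permsOn zᶜ, (MonoidAlgebra.single q (signHom q) *
      MonoidAlgebra.single p ((1 : Perm α →* ℚ) p)).coeff g =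
      if p = q⁻¹ * g then signHom q else 0 := by
    intro p _
    rw [MonoidAlgebra.single_mul_single, MonoidAlgebra.coeff_single, Finsupp.single_apply,
      MonoidHom.one_apply, mul_one]
    refine if_congr ?_ rfl rfl
    rw [eq_inv_mul_iff_mul_eq]
  rw [Finset.sum_congr rfl h1, Finset.sum_ite_eq']
  refine if_congr ?_ rfl rfl
  rw [mem_permsOn]
  simp only [Finset.mem_compl, not_not, Perm.mul_apply]
  refine forall₂_congr fun x _ => ?_
  rw [Perm.inv_eq_iff_eq, eq_comm]

theorem restrictedSign_conj (σ τ : Perm α) (z : Finset α) :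
    restrictedSign (τ⁻¹ * σ * τ) z = restrictedSign σ (z.map τ.toEmbedding) := by
  rw [restrictedSign, restrictedSign]
  refine Finset.sum_bij' (fun π _ => τ * π * τ⁻¹) (fun π _ => τ⁻¹ * π * τ) ?_ ?_
    (fun σ _ => by group) (fun σ _ => by group) (fun π _ => (map_conj_eq _ _ _).symm)
  · intro π hπ
    rw [Finset.mem_filter] at hπ ⊢
    simp only [mem_permsOn, Finset.mem_map_equiv, Perm.mul_apply] at hπ ⊢
    refine ⟨fun x hx => ?_, fun x hx => ?_⟩
    · rw [Perm.inv_def, hπ.1 _ hx, apply_symm_apply]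
    · rw [Perm.inv_def, hπ.2 _ hx, Perm.inv_def, apply_symm_apply, apply_symm_apply]
  · intro π hπ
    rw [Finset.mem_filter] at hπ ⊢
    simp only [mem_permsOn, Finset.mem_map_equiv, Perm.mul_apply] at hπ ⊢
    refine ⟨fun x hx => ?_, fun x hx => ?_⟩
    · rw [hπ.1 _ (by simpa using hx), Perm.inv_def, symm_apply_apply]
    · rw [hπ.2 _ (by simpa using hx)]

/-- The characters induced from the trivial times the sign character are the coefficients of
`det (1 + q P_σ)`. -/
theorem classSum_twistedSum_mul_twistedSum (z : Finset α) (σ : Perm α) :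
    classSum (twistedSum 1 zᶜ * twistedSum signHom z) σ =
      ((Fintype.card α - z.card).factorial * z.card.factorial : ℚ) *
        (cycleDet σ).coeff z.card := by
  rw [classSum_apply, coeff_cycleDet, ← sum_perm_map]
  refine Finset.sum_congr rfl fun τ _ => ?_
  rw [coeff_twistedSum_mul_twistedSum, restrictedSign_conj]

/-! ### The generating polynomial of hook characters -/

/-- The generating polynomial of the hook class functions. -/
def hookPoly (σ : Perm α) : Polynomial ℚ :=
  ∑ k ∈ Finset.range (Fintype.card α), Polynomial.C (hookChar k σ) * Polynomial.X ^ k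

theorem coeff_hookPoly (σ : Perm α) (k : ℕ) : (hookPoly σ).coeff k = hookChar k σ := by
  rw [hookPoly, Polynomial.finsetSum_coeff]
  simp_rw [Polynomial.coeff_C_mul_X_pow]
  rw [Finset.sum_ite_eq]
  split_ifs with h
  · rfl
  · rw [hookChar_eq_zero]
    simpa using h

/-- Multiplication by `1 + X` adds consecutive hook characters; each such sum and the matching
coefficient of `det (1 + q P_σ)` describe the same induced character, with the same nonzero
factorial normalisation. -/
theorem one_add_X_mul_hookPoly [Nonempty α] (σ : Perm α) :
    (1 + Polynomial.X) * hookPoly σ =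
      (σ.partition.parts.map fun b => 1 - (-Polynomial.X) ^ b).prod := by
  rw [← cycleDet_eq_prod]
  ext k
  rcases k with _ | k
  · have h1 := hookChar_zero σ
    rw [classSum_twistedSum_mul_twistedSum] at h1
    simp only [Finset.card_empty, Nat.sub_zero, Nat.factorial_zero, Nat.cast_one, mul_one] at h1
    rw [add_mul, one_mul, Polynomial.coeff_add, Polynomial.coeff_X_mul_zero, add_zero,
      coeff_hookPoly]
    exact mul_left_cancel₀ (by positivity) h1
  · rw [add_mul, one_mul, Polynomial.coeff_add, Polynomial.coeff_X_mul, coeff_hookPoly,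
      coeff_hookPoly]
    by_cases hk : k + 1 ≤ Fintype.card α
    · obtain ⟨z, _, hz⟩ := Finset.exists_subset_card_eq (s := (Finset.univ : Finset α))
        (n := k + 1) (by simpa using hk)
      have h1 := hookChar_succ_add z σ k hz
      rw [classSum_twistedSum_mul_twistedSum, hz] at h1
      exact mul_left_cancel₀ (by positivity) h1
    · rw [hookChar_eq_zero (by omega), hookChar_eq_zero (by omega), coeff_cycleDet,
        Finset.powersetCard_eq_empty.2 (by simpa using hk)]
      simp

end CycleDet

/-! ### Hook shapes and their characters -/

/-- The hook partition `(d - k, 1^k)`. -/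
def hookPartition {d : ℕ} (k : Fin d) : d.Partition where
  parts := (d - k) ::ₘ Multiset.replicate k 1
  parts_pos := by
    intro i hi
    rcases Multiset.mem_cons.1 hi with rfl | hi
    · have := k.2
      omega
    · rw [Multiset.eq_of_mem_replicate hi]
      exact one_pos
  parts_sum := by
    have := k.2
    rw [Multiset.sum_cons, Multiset.sum_replicate, smul_eq_mul, mul_one]
    omega

theorem sortedParts_hookPartition {d : ℕ} (k : Fin d) :
    sortedParts (hookPartition k) = (d - k) :: List.replicate k 1 := by
  have h1 : ((d - k : ℕ) :: List.replicate k 1).SortedGE := by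
    apply List.Pairwise.sortedGE
    rw [List.pairwise_cons]
    refine ⟨fun a ha => ?_, ?_⟩
    · rw [List.eq_of_mem_replicate ha]
      have := k.2
      change 1 ≤ d - (k : ℕ)
      omega
    · rw [List.pairwise_replicate]
      exact Or.inr le_rfl
  refine List.Perm.eq_of_sortedGE (sortedParts_sortedGE _) h1 ?_
  rw [← Multiset.coe_eq_coe, sortedParts, Multiset.sort_eq, hookPartition, ← Multiset.cons_coe,
    Multiset.coe_replicate]

theorem hookPartition_injective {d : ℕ} : Function.Injective (hookPartition (d := d)) := by
  intro k l h
  have h1 := congrArg (fun p : d.Partition => p.parts.card) h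
  simp only [hookPartition, Multiset.card_cons, Multiset.card_replicate] at h1
  exact Fin.ext (by omega)

theorem mem_youngDiagram_hookPartition {d : ℕ} (k : Fin d) {c : ℕ × ℕ} :
    c ∈ (youngDiagram (hookPartition k)).cells ↔
      (c.1 = 0 ∧ c.2 < d - k) ∨ (0 < c.1 ∧ c.1 ≤ k ∧ c.2 = 0) := by
  rw [YoungDiagram.mem_cells, youngDiagram, YoungDiagram.mem_ofRowLens]
  simp only [sortedParts_hookPartition]
  obtain ⟨i, j⟩ := c
  rcases i with _ | i
  · simp
  · simp only [List.length_cons, List.length_replicate, List.getElem_cons_succ,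
      List.getElem_replicate]
    constructor
    · rintro ⟨h1, h2⟩
      right
      omega
    · rintro (h | h)
      · omega
      · exact ⟨by omega, by omega⟩

section Tableau

variable {d : ℕ} {lam : d.Partition}

theorem Tableau.ext_row_col (t : Tableau lam) {x y : Fin d} (h1 : Tableau.row t x = Tableau.row t y)
    (h2 : Tableau.col t x = Tableau.col t y) : x = y :=
  t.injective (Subtype.ext (Prod.ext h1 h2))

/-- The letters in the first row of a tableau. -/
def Tableau.firstRow (t : Tableau lam) : Finset (Fin d) := {x | Tableau.row t x = 0}

/-- The letters in the first column of a tableau. -/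
def Tableau.firstCol (t : Tableau lam) : Finset (Fin d) := {x | Tableau.col t x = 0}

theorem Tableau.mem_firstRow (t : Tableau lam) {x : Fin d} :
    x ∈ Tableau.firstRow t ↔ Tableau.row t x = 0 := by
  simp [Tableau.firstRow]

theorem Tableau.mem_firstCol (t : Tableau lam) {x : Fin d} :
    x ∈ Tableau.firstCol t ↔ Tableau.col t x = 0 := by
  simp [Tableau.firstCol]

/-- A letter outside the first row is alone in its row, so every row-preserving permutation fixes
it. -/
theorem rowSymmetrizer_eq_twistedSum (t : Tableau lam)
    (h : ∀ x, Tableau.row t x = 0 ∨ Tableau.col t x = 0) :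
    rowSymmetrizer t = twistedSum 1 (Tableau.firstRow t) := by
  refine Finset.sum_congr ?_ fun _ _ => rfl
  ext σ
  rw [Finset.mem_filter, mem_permsOn]
  constructor
  · intro hσ x hx
    rw [Tableau.mem_firstRow] at hx
    have h1 := hσ.2 x
    have h2 : Tableau.col t (σ x) = 0 := (h (σ x)).resolve_left (by rw [h1]; exact hx)
    exact Tableau.ext_row_col t h1 (by rw [h2, (h x).resolve_left hx])
  · intro hσ
    refine ⟨Finset.mem_univ _, fun x => ?_⟩
    by_cases hx : x ∈ Tableau.firstRow t
    · have h1 := apply_mem_of_mem_permsOn (mem_permsOn.2 hσ) hx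
      rw [Tableau.mem_firstRow] at hx h1
      rw [hx, h1]
    · rw [hσ x hx]

theorem colAntisymmetrizer_eq_twistedSum (t : Tableau lam)
    (h : ∀ x, Tableau.row t x = 0 ∨ Tableau.col t x = 0) :
    colAntisymmetrizer t = twistedSum signHom (Tableau.firstCol t) := by
  refine Finset.sum_congr ?_ fun _ _ => rfl
  ext σ
  rw [Finset.mem_filter, mem_permsOn]
  constructor
  · intro hσ x hx
    rw [Tableau.mem_firstCol] at hx
    have h1 := hσ.2 x
    have h2 : Tableau.row t (σ x) = 0 := (h (σ x)).resolve_right (by rw [h1]; exact hx)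
    exact Tableau.ext_row_col t (by rw [h2, (h x).resolve_right hx]) h1
  · intro hσ
    refine ⟨Finset.mem_univ _, fun x => ?_⟩
    by_cases hx : x ∈ Tableau.firstCol t
    · have h1 := apply_mem_of_mem_permsOn (mem_permsOn.2 hσ) hx
      rw [Tableau.mem_firstCol] at hx h1
      rw [hx, h1]
    · rw [hσ x hx]

end Tableau

theorem row_or_col_hookPartition {d : ℕ} {k : Fin d} (t : Tableau (hookPartition k)) (x : Fin d) :
    Tableau.row t x = 0 ∨ Tableau.col t x = 0 := by
  rcases (mem_youngDiagram_hookPartition k).1 (t x).2 with h | h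
  · exact Or.inl h.1
  · exact Or.inr h.2.2

theorem isHook_hookPartition {d : ℕ} {k : Fin d} (t : Tableau (hookPartition k)) :
    ∃ o, IsHook (Tableau.firstRow t) (Tableau.firstCol t) o := by
  have h0 : ((0, 0) : ℕ × ℕ) ∈ (youngDiagram (hookPartition k)).cells := by
    rw [mem_youngDiagram_hookPartition]
    have := k.2
    exact Or.inl ⟨rfl, by simp only; omega⟩
  have h1 : t (t.symm ⟨(0, 0), h0⟩) = ⟨(0, 0), h0⟩ := t.apply_symm_apply _
  have hr : Tableau.row t (t.symm ⟨(0, 0), h0⟩) = 0 := by rw [Tableau.row, h1]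
  have hc : Tableau.col t (t.symm ⟨(0, 0), h0⟩) = 0 := by rw [Tableau.col, h1]
  refine ⟨t.symm ⟨(0, 0), h0⟩, fun x => ?_, ?_, ?_, fun x hx hx' => ?_⟩
  · rw [Tableau.mem_firstRow, Tableau.mem_firstCol]
    exact row_or_col_hookPartition t x
  · rwa [Tableau.mem_firstRow]
  · rwa [Tableau.mem_firstCol]
  · rw [Tableau.mem_firstRow] at hx
    rw [Tableau.mem_firstCol] at hx'
    exact Tableau.ext_row_col t (hx.trans hr.symm) (hx'.trans hc.symm)

theorem card_firstCol_hookPartition {d : ℕ} {k : Fin d} (t : Tableau (hookPartition k)) :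
    (Tableau.firstCol t).card = k + 1 := by
  rw [← Finset.card_range (k + 1)]
  have hk := k.2
  refine Finset.card_bij (fun x _ => Tableau.row t x) ?_ ?_ ?_
  · intro x hx
    rw [Finset.mem_range]
    rcases (mem_youngDiagram_hookPartition k).1 (t x).2 with h | h
    · rw [Tableau.row, h.1]
      omega
    · have := h.2.1
      rw [Tableau.row]
      omega
  · intro x hx y hy h
    rw [Tableau.mem_firstCol] at hx hy
    exact Tableau.ext_row_col t h (hx.trans hy.symm)
  · intro i hi
    rw [Finset.mem_range] at hi
    have h0 : ((i, 0) : ℕ × ℕ) ∈ (youngDiagram (hookPartition k)).cells := by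
      rw [mem_youngDiagram_hookPartition]
      rcases Nat.eq_zero_or_pos i with h | h
      · exact Or.inl ⟨h, by simp only; omega⟩
      · exact Or.inr ⟨h, by simp only; omega, rfl⟩
    have h1 : t (t.symm ⟨(i, 0), h0⟩) = ⟨(i, 0), h0⟩ := t.apply_symm_apply _
    refine ⟨t.symm ⟨(i, 0), h0⟩, ?_, ?_⟩
    · rw [Tableau.mem_firstCol, Tableau.col, h1]
    · rw [Tableau.row, h1]

/-- The trace formula for quasi-idempotents produces the inverse, which is harmless later because
`σ` and `σ⁻¹` have the same cycle type. -/
theorem irrChar_hookPartition {d : ℕ} (k : Fin d) (σ : Perm (Fin d)) :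
    irrChar (hookPartition k) σ = hookChar k σ⁻¹ := by
  have key : ∀ t : Tableau (hookPartition k), (spechtRep t).character σ = hookChar k σ⁻¹ := by
    intro t
    obtain ⟨o, ho⟩ := isHook_hookPartition t
    have hc := card_firstCol_hookPartition t
    have hy : youngSymmetrizer t =
        hookSymmetrizer (Tableau.firstRow t) (Tableau.firstCol t) := by
      rw [youngSymmetrizer, hookSymmetrizer,
        rowSymmetrizer_eq_twistedSum t (row_or_col_hookPartition t),
        colAntisymmetrizer_eq_twistedSum t (row_or_col_hookPartition t)]
    have hsq := ho.hookSymmetrizer_mul_self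
    rw [ho.card_row hc, hc, Nat.add_sub_cancel, ← hy] at hsq
    rw [hookChar_eq ho hc, ← hy]
    refine trace_span_singleton (youngSymmetrizer t) ?_ hsq σ
    have : 0 < Fintype.card (Fin d) := Fintype.card_pos_iff.2 ⟨o⟩
    positivity
  exact key _

/-! ### Characters on the class of long cycles -/

section EvalNegOne

variable {α : Type*} [Fintype α] [DecidableEq α]

theorem one_sub_neg_X_pow (b : ℕ) : (1 - (-Polynomial.X) ^ b : Polynomial ℚ) =
    (1 + Polynomial.X) * ∑ i ∈ Finset.range b, (-Polynomial.X) ^ i := by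
  have := mul_neg_geom_sum (-Polynomial.X : Polynomial ℚ) b
  rw [sub_neg_eq_add] at this
  exact this.symm

theorem one_add_X_ne_zero : (1 + Polynomial.X : Polynomial ℚ) ≠ 0 := by
  rw [add_comm]
  exact Polynomial.X_add_C_ne_zero 1

theorem hookPoly_of_parts_eq_singleton [Nonempty α] {σ : Perm α} {b : ℕ}
    (h : σ.partition.parts = {b}) : hookPoly σ = ∑ i ∈ Finset.range b, (-Polynomial.X) ^ i := by
  have h1 := one_add_X_mul_hookPoly σ
  rw [h, Multiset.map_singleton, Multiset.prod_singleton, one_sub_neg_X_pow] at h1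
  exact mul_left_cancel₀ one_add_X_ne_zero h1

/-- Each part contributes a factor `1 + X`. With two parts or more, one of these remains after
cancellation and vanishes at `-1`. -/
theorem eval_hookPoly_of_one_lt_card [Nonempty α] {σ : Perm α}
    (h : 1 < σ.partition.parts.card) : (hookPoly σ).eval (-1) = 0 := by
  have h1 := one_add_X_mul_hookPoly σ
  obtain ⟨a, b, m, hm⟩ : ∃ a b m, σ.partition.parts = a ::ₘ b ::ₘ m := by
    generalize σ.partition.parts = p at h
    induction p using Multiset.induction_on with
    | empty => simp at h
    | cons a p _ =>
      induction p using Multiset.induction_on with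
      | empty => simp at h
      | cons b p _ => exact ⟨a, b, p, rfl⟩
  rw [hm, Multiset.map_cons, Multiset.map_cons, Multiset.prod_cons, Multiset.prod_cons,
    one_sub_neg_X_pow a, mul_assoc] at h1
  rw [mul_left_cancel₀ one_add_X_ne_zero h1, one_sub_neg_X_pow b]
  simp

end EvalNegOne

theorem hookChar_of_parts_eq_singleton {d : ℕ} {σ : Perm (Fin d)} (k : Fin d)
    (h : σ.partition.parts = {d}) : hookChar k σ = (-1) ^ (k : ℕ) := by
  have : Nonempty (Fin d) := ⟨k⟩
  rw [← coeff_hookPoly, hookPoly_of_parts_eq_singleton h, Polynomial.finsetSum_coeff]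
  simp_rw [neg_pow (Polynomial.X : Polynomial ℚ)]
  have : ∀ i : ℕ, ((-1) ^ i * Polynomial.X ^ i : Polynomial ℚ).coeff k =
      if (k : ℕ) = i then (-1) ^ (k : ℕ) else 0 := by
    intro i
    have e : ((-1) ^ i : Polynomial ℚ) = Polynomial.C ((-1) ^ i) := by simp
    rw [e, Polynomial.coeff_C_mul_X_pow]
    split_ifs with hi
    · rw [hi]
    · rfl
  simp_rw [this]
  rw [Finset.sum_ite_eq, if_pos (Finset.mem_range.2 k.2)]

/-- The alternating sum of hook characters serves as an indicator of long cycles, expressing their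
class sum through hook symmetrizers. -/
theorem eval_hookPoly {d : ℕ} (hd : 0 < d) (σ : Perm (Fin d)) :
    (hookPoly σ).eval (-1) = if σ.partition.parts = {d} then (d : ℚ) else 0 := by
  have : Nonempty (Fin d) := ⟨⟨0, hd⟩⟩
  split_ifs with h
  · rw [hookPoly_of_parts_eq_singleton h, Polynomial.eval_finsetSum]
    simp
  · apply eval_hookPoly_of_one_lt_card
    by_contra hcon
    have hsum := σ.partition.parts_sum.trans (Fintype.card_fin d)
    have hc : σ.partition.parts.card = 0 ∨ σ.partition.parts.card = 1 := by omega
    rcases hc with hc | hc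
    · rw [Multiset.card_eq_zero] at hc
      rw [hc] at hsum
      simp at hsum
      omega
    · obtain ⟨a, ha⟩ := Multiset.card_eq_one.1 hc
      rw [ha, Multiset.sum_singleton] at hsum
      exact h (by rw [ha, hsum])

/-- Allows an annihilation property stable under conjugation to pass from `x` to the central element
with coefficients `classSum x`. -/
theorem sum_single_classSum {G : Type*} [Group G] [Fintype G] (x : MonoidAlgebra ℚ G) :
    ∑ σ : G, MonoidAlgebra.single σ (classSum x σ) =
      ∑ τ : G, MonoidAlgebra.single τ 1 * x * MonoidAlgebra.single τ⁻¹ 1 := by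
  classical
  ext σ
  simp only [MonoidAlgebra.coeff_sum, Finsupp.finsetSum_apply, MonoidAlgebra.coeff_single,
    Finsupp.single_apply, MonoidAlgebra.coeff_mul_single_apply,
    MonoidAlgebra.coeff_single_mul_apply]
  rw [Finset.sum_ite_eq', if_pos (Finset.mem_univ _), classSum_apply]
  simp [mul_assoc]

/-- If the Young symmetrizers of all hooks annihilate a left ideal of `ℚ S_d`, then so does the
weighted sum of all long cycles. -/
theorem sum_eval_hookPoly_mul_eq_zero {d : ℕ} (x : GroupAlg d)
    (hx : ∀ (s t : Finset (Fin d)) (o : Fin d), IsHook s t o → ∀ y : GroupAlg d,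
      hookSymmetrizer s t * y * x = 0) (y : GroupAlg d) :
    (∑ σ : Perm (Fin d), MonoidAlgebra.single σ ((hookPoly σ).eval (-1))) * (y * x) = 0 := by
  have h1 : ∀ k, k < d → (∑ σ : Perm (Fin d), MonoidAlgebra.single σ (hookChar k σ)) *
      (y * x) = 0 := by
    intro k hk
    obtain ⟨z, _, hz⟩ := Finset.exists_subset_card_eq (s := (Finset.univ : Finset (Fin d)))
      (n := k) (by simpa using hk.le)
    have hne : zᶜ.Nonempty := by
      rw [← Finset.card_pos, Finset.card_compl, hz, Fintype.card_fin]
      omega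
    obtain ⟨o, ho⟩ := hne
    have ho' := Finset.mem_compl.1 ho
    have hh := isHook_compl_insert ho'
    have hc : (insert o z).card = k + 1 := by rw [Finset.card_insert_of_notMem ho', hz]
    have h2 : ∑ σ : Perm (Fin d), MonoidAlgebra.single σ (hookChar k σ) =
        ((Fintype.card (Fin d) * ((Fintype.card (Fin d) - 1 - k).factorial * k.factorial)) : ℚ)⁻¹ •
        ∑ σ : Perm (Fin d), MonoidAlgebra.single σ
          (classSum (hookSymmetrizer zᶜ (insert o z)) σ) := by
      rw [Finset.smul_sum]
      refine Finset.sum_congr rfl fun σ _ => ?_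
      rw [MonoidAlgebra.smul_single, hookChar_eq hh hc, smul_eq_mul, div_eq_inv_mul]
    rw [h2, sum_single_classSum, smul_mul_assoc, Finset.sum_mul, Finset.sum_eq_zero, smul_zero]
    intro τ _
    have h3 := hx _ _ _ hh (MonoidAlgebra.single τ⁻¹ 1 * y)
    calc _ = MonoidAlgebra.single τ 1 * (hookSymmetrizer zᶜ (insert o z) *
          (MonoidAlgebra.single τ⁻¹ 1 * y) * x) := by simp only [mul_assoc]
      _ = 0 := by rw [h3, mul_zero]
  have h4 : ∑ σ : Perm (Fin d), MonoidAlgebra.single σ ((hookPoly σ).eval (-1)) =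
      ∑ k ∈ Finset.range d, ((-1) ^ k : ℚ) •
        ∑ σ : Perm (Fin d), MonoidAlgebra.single σ (hookChar k σ) := by
    simp_rw [Finset.smul_sum]
    rw [Finset.sum_comm]
    refine Finset.sum_congr rfl fun σ _ => ?_
    rw [hookPoly, Polynomial.eval_finsetSum, Fintype.card_fin]
    ext g
    simp only [MonoidAlgebra.coeff_sum, Finsupp.finsetSum_apply, MonoidAlgebra.coeff_single,
      Finsupp.single_apply, MonoidAlgebra.smul_single]
    split_ifs
    · refine Finset.sum_congr rfl fun k _ => ?_
      rw [Polynomial.eval_mul, Polynomial.eval_C, Polynomial.eval_pow, Polynomial.eval_X,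
        smul_eq_mul, mul_comm]
    · rw [Finset.sum_const_zero]
  rw [h4, Finset.sum_mul]
  refine Finset.sum_eq_zero fun k hk => ?_
  rw [smul_mul_assoc, h1 k (Finset.mem_range.1 hk), smul_zero]

/-! ### Vanishing of non-hook characters on long cycles -/

theorem length_le_sum_and_eq_replicate (l : List ℕ) (hl : ∀ x ∈ l, 0 < x) :
    l.length ≤ l.sum ∧ (l.sum = l.length → l = List.replicate l.length 1) := by
  induction l with
  | nil => simp
  | cons a l ih =>
    obtain ⟨h1, h2⟩ := ih fun x hx => hl x (List.mem_cons_of_mem _ hx)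
    have ha := hl a List.mem_cons_self
    rw [List.length_cons, List.sum_cons, List.replicate_succ]
    refine ⟨by omega, fun h => ?_⟩
    rw [← h2 (by omega)]
    congr 1
    omega

/-- A partition which is not a hook fits into a box whose semiperimeter is at most its size. -/
theorem eq_hookPartition_or_exists_box {d : ℕ} (hd : 0 < d) (lam : d.Partition) :
    (∃ k : Fin d, lam = hookPartition k) ∨
      ∃ a l : ℕ, a + l ≤ d ∧ ∀ c ∈ (youngDiagram lam).cells, c.1 < l ∧ c.2 < a := by
  have hparts : (sortedParts lam : Multiset ℕ) = lam.parts := Multiset.sort_eq _ _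
  have hsum : (sortedParts lam).sum = d := by
    rw [← Multiset.sum_coe, hparts, lam.parts_sum]
  have hpos : ∀ x ∈ sortedParts lam, 0 < x := by
    intro x hx
    rw [← Multiset.mem_coe, hparts] at hx
    exact lam.parts_pos hx
  have hcells : ∀ c ∈ (youngDiagram lam).cells,
      ∃ h : c.1 < (sortedParts lam).length, c.2 < (sortedParts lam)[c.1] := fun c hc =>
    YoungDiagram.mem_ofRowLens.1 ((YoungDiagram.mem_cells _).1 hc)
  have hsorted := sortedParts_sortedGE lam
  generalize sortedParts lam = w at *
  rcases w with _ | ⟨a, w⟩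
  · simp at hsum
    omega
  · have ha := hpos a List.mem_cons_self
    obtain ⟨h1, h2⟩ := length_le_sum_and_eq_replicate w
      fun x hx => hpos x (List.mem_cons_of_mem _ hx)
    rw [List.sum_cons] at hsum
    -- `w` lists the parts after the first. The shape is a hook exactly when they are all `1`;
    -- otherwise their sum exceeds their number, leaving room for the extra row in the box.
    by_cases h : w.sum = w.length
    · left
      refine ⟨⟨w.length, by omega⟩, ?_⟩
      apply Nat.Partition.ext
      rw [← hparts]
      change _ = (d - w.length) ::ₘ Multiset.replicate w.length 1
      rw [← Multiset.cons_coe, ← Multiset.coe_replicate, ← h2 h]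
      congr 1
      omega
    · right
      refine ⟨a, w.length + 1, by omega, fun c hc => ?_⟩
      obtain ⟨h3, h4⟩ := hcells c hc
      refine ⟨h3, h4.trans_le ?_⟩
      exact hsorted.getElem_ge_getElem_of_le (hj := Nat.succ_pos _) (Nat.zero_le c.1)

section Tableau

variable {d : ℕ} {lam : d.Partition}

theorem single_swap_mul_rowSymmetrizer (t : Tableau lam) {x y : Fin d}
    (h : Tableau.row t x = Tableau.row t y) :
    MonoidAlgebra.single (swap x y) 1 * rowSymmetrizer t = rowSymmetrizer t := by
  have hrow : ∀ z, Tableau.row t (swap x y z) = Tableau.row t z := by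
    intro z
    rw [swap_apply_def]
    split_ifs with h1 h2
    · rw [h1, h]
    · rw [h2, h]
    · rfl
  rw [rowSymmetrizer, Finset.mul_sum]
  refine Finset.sum_bij' (fun σ _ => swap x y * σ) (fun σ _ => swap x y * σ) ?_ ?_
    (fun σ _ => by simp) (fun σ _ => by simp) (fun σ _ => ?_)
  · intro σ hσ
    rw [Finset.mem_filter] at hσ ⊢
    exact ⟨Finset.mem_univ _, fun z => by rw [Perm.mul_apply, hrow, hσ.2]⟩
  · intro σ hσ
    rw [Finset.mem_filter] at hσ ⊢
    exact ⟨Finset.mem_univ _, fun z => by rw [Perm.mul_apply, hrow, hσ.2]⟩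
  · rw [MonoidAlgebra.single_mul_single, one_mul]

theorem single_swap_mul_colAntisymmetrizer (t : Tableau lam) {x y : Fin d} (hxy : x ≠ y)
    (h : Tableau.col t x = Tableau.col t y) :
    MonoidAlgebra.single (swap x y) 1 * colAntisymmetrizer t = -colAntisymmetrizer t := by
  have hcol : ∀ z, Tableau.col t (swap x y z) = Tableau.col t z := by
    intro z
    rw [swap_apply_def]
    split_ifs with h1 h2
    · rw [h1, h]
    · rw [h2, h]
    · rfl
  rw [colAntisymmetrizer, Finset.mul_sum, ← Finset.sum_neg_distrib]
  refine Finset.sum_bij' (fun σ _ => swap x y * σ) (fun σ _ => swap x y * σ) ?_ ?_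
    (fun σ _ => by simp) (fun σ _ => by simp) (fun σ _ => ?_)
  · intro σ hσ
    rw [Finset.mem_filter] at hσ ⊢
    exact ⟨Finset.mem_univ _, fun z => by rw [Perm.mul_apply, hcol, hσ.2]⟩
  · intro σ hσ
    rw [Finset.mem_filter] at hσ ⊢
    exact ⟨Finset.mem_univ _, fun z => by rw [Perm.mul_apply, hcol, hσ.2]⟩
  · rw [MonoidAlgebra.single_mul_single, one_mul, Perm.sign_mul, Perm.sign_swap hxy,
      ← MonoidAlgebra.single_neg]
    simp

end Tableau

theorem mul_mul_eq_zero_of_single {G : Type*} [Group G] {u v : MonoidAlgebra ℚ G}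
    (h : ∀ g, u * MonoidAlgebra.single g 1 * v = 0) (y : MonoidAlgebra ℚ G) : u * y * v = 0 := by
  induction y using MonoidAlgebra.induction_linear with
  | zero => simp
  | add f g hf hg => rw [mul_add, add_mul, hf, hg, add_zero]
  | single g r =>
    have : MonoidAlgebra.single g r = r • (MonoidAlgebra.single g 1 : MonoidAlgebra ℚ G) := by
      rw [MonoidAlgebra.smul_single, smul_eq_mul, mul_one]
    rw [this, mul_smul_comm, smul_mul_assoc, h, smul_zero]

/-- Among more than `n` letters two agree under a function with values less than `n`. -/
theorem exists_ne_of_card_gt {d n : ℕ} {s : Finset (Fin d)} (hs : n < s.card) (f : Fin d → ℕ)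
    (hf : ∀ x, f x < n) (g : Perm (Fin d)) :
    ∃ x y, x ≠ y ∧ f x = f y ∧ g x ∈ s ∧ g y ∈ s := by
  obtain ⟨x, hx, y, hy, hxy, h⟩ := Finset.exists_ne_map_eq_of_card_lt_of_maps_to
    (s := s) (t := Finset.range n) (f := fun x => f (g⁻¹ x)) (by simpa using hs)
    (fun x _ => Finset.mem_coe.2 (Finset.mem_range.2 (hf _)))
  exact ⟨g⁻¹ x, g⁻¹ y, fun h' => hxy (g⁻¹.injective h'), h, by simpa using hx, by simpa using hy⟩

/-- The hook's row and column have `d + 1 > a + l` letters in total, so its row exceeds the box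
width or its column exceeds the box height. By pigeonhole two letters of that row share a tableau
column, or two of that column share a tableau row, and their transposition acts with opposite signs
on the two sides. -/
theorem hookSymmetrizer_mul_mul_youngSymmetrizer {d : ℕ} {lam : d.Partition} (t : Tableau lam)
    {a l : ℕ} (hal : a + l ≤ d) (hbox : ∀ c ∈ (youngDiagram lam).cells, c.1 < l ∧ c.2 < a)
    {s₁ t₁ : Finset (Fin d)} {o : Fin d} (h : IsHook s₁ t₁ o) (y : GroupAlg d) :
    hookSymmetrizer s₁ t₁ * y * youngSymmetrizer t = 0 := by
  have hcard := h.card_add_card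
  rw [Fintype.card_fin] at hcard
  have hcase : a < s₁.card ∨ l < t₁.card := by omega
  rcases hcase with hc | hc
  · have h0 : ∀ z, twistedSum 1 s₁ * z * colAntisymmetrizer t = 0 := by
      refine mul_mul_eq_zero_of_single fun g => ?_
      obtain ⟨x, y, hxy, hf, hx, hy⟩ := exists_ne_of_card_gt hc (Tableau.col t)
        (fun x => (hbox _ (t x).2).2) g
      exact mul_single_mul_eq_zero one_ne_zero
        (by rw [one_smul, twistedSum_one_mul_single_swap hx hy])
        (by rw [one_smul, single_swap_mul_colAntisymmetrizer t hxy hf])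
    calc _ = twistedSum 1 s₁ * (twistedSum signHom t₁ * y * rowSymmetrizer t) *
          colAntisymmetrizer t := by simp only [hookSymmetrizer, youngSymmetrizer, mul_assoc]
      _ = 0 := h0 _
  · have h0 : ∀ z, twistedSum signHom t₁ * z * rowSymmetrizer t = 0 := by
      refine mul_mul_eq_zero_of_single fun g => ?_
      obtain ⟨x, y, hxy, hf, hx, hy⟩ := exists_ne_of_card_gt hc (Tableau.row t)
        (fun x => (hbox _ (t x).2).1) g
      refine mul_single_mul_eq_zero (x := x) (y := y) (neg_ne_zero.2 one_ne_zero) ?_ ?_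
      · rw [neg_smul, one_smul, twistedSum_signHom_mul_single_swap (g.injective.ne hxy) hx hy]
      · rw [neg_smul, one_smul, neg_neg, single_swap_mul_rowSymmetrizer t hf]
    calc _ = twistedSum 1 s₁ * (twistedSum signHom t₁ * y * rowSymmetrizer t) *
          colAntisymmetrizer t := by simp only [hookSymmetrizer, youngSymmetrizer, mul_assoc]
      _ = 0 := by rw [h0, mul_zero, zero_mul]

theorem parts_partition_permOfPartition {d : ℕ} (mu : d.Partition) :
    (permOfPartition mu).partition.parts = mu.parts :=
  (exists_perm_of_partition mu).choose_spec

theorem character_spechtRep_eq_of_parts_eq {d : ℕ} {lam : d.Partition} (t : Tableau lam)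
    {σ τ : Perm (Fin d)} (h : σ.partition.parts = τ.partition.parts) :
    (spechtRep t).character σ = (spechtRep t).character τ := by
  obtain ⟨g, hg⟩ := isConj_iff.1 (Perm.partition_eq_of_isConj.2 (Nat.Partition.ext h))
  rw [← hg, Representation.char_conj]

/-- The weighted sum of long cycles acts as zero on the Specht module. Its trace is the character
value times `d` times the number of long cycles, and the last two are nonzero. -/
theorem chi_eq_zero_of_box {d : ℕ} (hd : 0 < d) {lam : d.Partition} {a l : ℕ} (hal : a + l ≤ d)
    (hbox : ∀ c ∈ (youngDiagram lam).cells, c.1 < l ∧ c.2 < a) :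
    chi lam (Nat.Partition.indiscrete d) = 0 := by
  have key : ∀ t : Tableau lam,
      (spechtRep t).character (permOfPartition (Nat.Partition.indiscrete d)) = 0 := by
    intro t
    have hparts := parts_partition_permOfPartition (Nat.Partition.indiscrete d)
    rw [Nat.Partition.indiscrete_parts hd.ne'] at hparts
    have h0 : Algebra.lsmul ℚ ℚ (SpechtModule t) (∑ σ : Perm (Fin d),
        MonoidAlgebra.single σ ((hookPoly σ).eval (-1))) = 0 := by
      ext1 ⟨x, hx⟩
      apply Subtype.ext
      obtain ⟨y, rfl⟩ := Submodule.mem_span_singleton.1 hx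
      exact sum_eval_hookPoly_mul_eq_zero _ (fun s t' o h y =>
        hookSymmetrizer_mul_mul_youngSymmetrizer t hal hbox h y) y
    have h1 := congrArg (LinearMap.trace ℚ (SpechtModule t)) h0
    rw [map_zero, map_sum, map_sum] at h1
    have h2 : ∀ σ : Perm (Fin d), LinearMap.trace ℚ (SpechtModule t)
        (Algebra.lsmul ℚ ℚ (SpechtModule t)
          (MonoidAlgebra.single σ ((hookPoly σ).eval (-1)))) =
        if σ.partition.parts = {d} then
          d * (spechtRep t).character (permOfPartition (Nat.Partition.indiscrete d)) else 0 := by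
      intro σ
      have h3 : MonoidAlgebra.single σ ((hookPoly σ).eval (-1)) =
          (hookPoly σ).eval (-1) • MonoidAlgebra.of ℚ (Perm (Fin d)) σ := by
        rw [MonoidAlgebra.of_apply, MonoidAlgebra.smul_single, smul_eq_mul, mul_one]
      have h4 : LinearMap.trace ℚ (SpechtModule t) (Algebra.lsmul ℚ ℚ (SpechtModule t)
          (MonoidAlgebra.of ℚ (Perm (Fin d)) σ)) = (spechtRep t).character σ := rfl
      rw [h3, map_smul, map_smul, h4, eval_hookPoly hd, smul_eq_mul, ite_mul, zero_mul]
      split_ifs with h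
      · rw [character_spechtRep_eq_of_parts_eq t (h.trans hparts.symm)]
      · rfl
    rw [Finset.sum_congr rfl fun σ _ => h2 σ, ← Finset.sum_filter, Finset.sum_const,
      nsmul_eq_mul] at h1
    rcases mul_eq_zero.1 h1 with h5 | h5
    · rw [Nat.cast_eq_zero, Finset.card_eq_zero] at h5
      have h6 : permOfPartition (Nat.Partition.indiscrete d) ∈
          ({σ | σ.partition.parts = {d}} : Finset (Perm (Fin d))) := by
        simpa using hparts
      rw [h5] at h6
      exact absurd h6 (Finset.notMem_empty _)
    · refine (mul_eq_zero.1 h5).resolve_left ?_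
      exact_mod_cast hd.ne'
  exact key _

/-! ### The double Hurwitz number as a sum over hooks -/

theorem parts_partition_inv {d : ℕ} (σ : Perm (Fin d)) :
    σ⁻¹.partition.parts = σ.partition.parts := by
  rw [Perm.parts_partition, Perm.parts_partition, Perm.cycleType_inv, Perm.support_inv]

theorem chi_hookPartition {d : ℕ} (k : Fin d) (mu : d.Partition) :
    chi (hookPartition k) mu = hookChar k (permOfPartition mu)⁻¹ :=
  irrChar_hookPartition k _

theorem chi_hookPartition_indiscrete {d : ℕ} (k : Fin d) :
    chi (hookPartition k) (Nat.Partition.indiscrete d) = (-1) ^ (k : ℕ) := by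
  have hd : d ≠ 0 := by
    have := k.2
    omega
  rw [chi_hookPartition, hookChar_of_parts_eq_singleton]
  rw [parts_partition_inv, parts_partition_permOfPartition, Nat.Partition.indiscrete_parts hd]

theorem sum_chi_indiscrete_mul {d : ℕ} (hd : 0 < d) (f : d.Partition → ℚ) :
    ∑ lam : d.Partition, chi lam (Nat.Partition.indiscrete d) * f lam =
      ∑ k : Fin d, (-1) ^ (k : ℕ) * f (hookPartition k) := by
  classical
  rw [← Finset.sum_subset (Finset.subset_univ (Finset.univ.image (hookPartition (d := d)))),
    Finset.sum_image fun _ _ _ _ h => hookPartition_injective h]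
  · refine Finset.sum_congr rfl fun k _ => ?_
    rw [chi_hookPartition_indiscrete]
  · intro lam _ hlam
    rcases eq_hookPartition_or_exists_box hd lam with ⟨k, rfl⟩ | ⟨a, l, hal, hbox⟩
    · exact absurd (Finset.mem_image_of_mem _ (Finset.mem_univ k)) hlam
    · rw [chi_eq_zero_of_box hd hal hbox, zero_mul]

/-- Rows below the first telescope, leaving `A³ + B³` with `A = d - k - 1/2` and `B = k + 1/2`.
Since `A + B = d`, this is `d (3u² + d²/4)` with `u = (B - A)/2`. -/
theorem shiftedPowerSum_hookPartition {d : ℕ} (k : Fin d) :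
    shiftedPowerSum 3 (hookPartition k) / 6 =
      d / 2 * (((k : ℚ) - (d - 1) / 2) ^ 2 + d ^ 2 / 12) := by
  have h1 : ∀ w : List ℕ, (∑ i : Fin w.length,
      (((w.get i : ℚ) - (i : ℚ) - 1 / 2) ^ 3 - (-(i : ℚ) - 1 / 2) ^ 3)) =
      ∑ i ∈ Finset.range w.length,
        (((w.getD i 0 : ℚ) - (i : ℚ) - 1 / 2) ^ 3 - (-(i : ℚ) - 1 / 2) ^ 3) := by
    intro w
    rw [Finset.sum_range]
    refine Finset.sum_congr rfl fun i _ => ?_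
    simp
  have h2 : ∀ n : ℕ, ∑ i ∈ Finset.range n,
      (((1 : ℚ) - ((i + 1 : ℕ) : ℚ) - 1 / 2) ^ 3 - (-((i + 1 : ℕ) : ℚ) - 1 / 2) ^ 3) =
        ((n : ℚ) + 1 / 2) ^ 3 - 1 / 8 := by
    intro n
    induction n with
    | zero => norm_num
    | succ n ih =>
      rw [Finset.sum_range_succ, ih]
      push_cast
      ring
  have hk := k.2
  have h3 : ∀ i ∈ Finset.range (k : ℕ), ((((d - (k : ℕ)) :: List.replicate k 1 : List ℕ).getD
      (i + 1) 0 : ℕ) : ℚ) = 1 := by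
    intro i hi
    simp [List.getD_eq_getElem?_getD, Finset.mem_range.1 hi]
  rw [shiftedPowerSum, h1, sortedParts_hookPartition, List.length_cons, List.length_replicate,
    Finset.sum_range_succ', Finset.sum_congr rfl fun i hi => by rw [h3 i hi], h2,
    List.getD_cons_zero, Nat.cast_sub hk.le]
  push_cast
  ring

theorem doubleHurwitz_eq_sum_hooks {d : ℕ} (hd : 0 < d) (g s : ℕ) (β : d.Partition)
    (hs : (2 * s : ℤ) = 2 * g - 1 + len β) :
    doubleHurwitz g 2 (Nat.Partition.indiscrete d) β =
      (d : ℚ) ^ ((s : ℤ) - 1) / (2 ^ s * (β.parts.prod : ℚ)) *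
        ∑ k ∈ Finset.range d, (-1) ^ k * (((k : ℚ) - (d - 1) / 2) ^ 2 + d ^ 2 / 12) ^ s *
          (hookPoly (permOfPartition β)⁻¹).coeff k := by
  have hlen : len (Nat.Partition.indiscrete d) = 1 := by
    rw [len, Nat.Partition.indiscrete_parts hd.ne', Multiset.card_singleton]
  have hn : numCycles g 2 (Nat.Partition.indiscrete d) β = s := by
    rw [numCycles, hlen]
    omega
  have hd' : (d : ℚ) ≠ 0 := by exact_mod_cast hd.ne'
  rw [doubleHurwitz, hn, Nat.Partition.indiscrete_parts hd.ne', Multiset.prod_singleton]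
  simp_rw [mul_assoc (chi _ _)]
  rw [sum_chi_indiscrete_mul hd, Finset.sum_range, Finset.mul_sum, Finset.mul_sum]
  refine Finset.sum_congr rfl fun k _ => ?_
  have h6 : (((2 + 1).factorial : ℕ) : ℚ) = 6 := by norm_num [Nat.factorial]
  rw [h6, shiftedPowerSum_hookPartition, chi_hookPartition, coeff_hookPoly, mul_pow, div_pow,
    zpow_sub_one₀ hd', zpow_natCast]
  ring

/-! ### Logarithmic derivatives of power series -/

/-- `F' = F G'`, that is, `G` is a logarithm of `F` up to a constant. -/
def HasLog (F G : ℚ⟦X⟧) : Prop :=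
  PowerSeries.derivative ℚ F = F * PowerSeries.derivative ℚ G

theorem hasLog_one : HasLog 1 0 := by
  rw [HasLog, map_zero, mul_zero]
  exact PowerSeries.derivative_one

theorem HasLog.mul {F₁ F₂ G₁ G₂ : ℚ⟦X⟧} (h₁ : HasLog F₁ G₁) (h₂ : HasLog F₂ G₂) :
    HasLog (F₁ * F₂) (G₁ + G₂) := by
  rw [HasLog] at *
  rw [Derivation.leibniz, h₁, h₂, map_add, smul_eq_mul, smul_eq_mul]
  ring

theorem HasLog.inv {F G : ℚ⟦X⟧} (h : HasLog F G) (hF : constantCoeff F ≠ 0) :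
    HasLog F⁻¹ (-G) := by
  rw [HasLog] at *
  rw [PowerSeries.derivative_inv', h, map_neg]
  linear_combination -(F⁻¹ * PowerSeries.derivative ℚ G) * PowerSeries.inv_mul_cancel F hF

theorem HasLog.multiset_prod (m : Multiset ℕ) {F G : ℕ → ℚ⟦X⟧} (h : ∀ i, HasLog (F i) (G i)) :
    HasLog (m.map F).prod (m.map G).sum := by
  induction m using Multiset.induction_on with
  | empty => simpa using hasLog_one
  | cons a m ih =>
    rw [Multiset.map_cons, Multiset.map_cons, Multiset.prod_cons, Multiset.sum_cons]
    exact (h a).mul ih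

theorem derivative_rescale (a : ℚ) (F : ℚ⟦X⟧) :
    PowerSeries.derivative ℚ (rescale a F) = C a * rescale a (PowerSeries.derivative ℚ F) := by
  ext n
  rw [PowerSeries.coeff_derivative, coeff_rescale, coeff_C_mul, coeff_rescale,
    PowerSeries.coeff_derivative]
  ring

theorem HasLog.rescale {F G : ℚ⟦X⟧} (h : HasLog F G) (a : ℚ) :
    HasLog (PowerSeries.rescale a F) (PowerSeries.rescale a G) := by
  rw [HasLog] at *
  rw [derivative_rescale, derivative_rescale, h, map_mul]
  ring

/-- Chain rule for `log (1 + x)` at `x = F - 1`, where `log' · (1 + x) = 1`. -/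
theorem hasLog_logOf {F : ℚ⟦X⟧} (hF : constantCoeff F = 1) : HasLog F (logOf F) := by
  have hs : HasSubst (F - 1) := HasSubst.of_constantCoeff_zero' (by simp [hF])
  have h1 : PowerSeries.derivative ℚ (PowerSeries.log ℚ) * (1 + X) = 1 := by
    rw [PowerSeries.deriv_log]
    ext n
    rw [mul_add, mul_one, map_add]
    rcases n with _ | n
    · simp
    · rw [coeff_succ_mul_X, coeff_mk, coeff_mk, coeff_one]
      simp [pow_succ]
  have h2 := congrArg (PowerSeries.subst (F - 1)) h1
  rw [subst_mul hs, subst_add hs, subst_X hs] at h2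
  have h3 : PowerSeries.subst (F - 1) (1 : ℚ⟦X⟧) = 1 := by
    rw [← coe_substAlgHom hs, map_one]
  rw [h3, add_sub_cancel] at h2
  rw [HasLog, logOf_eq, PowerSeries.derivative_subst hs, map_sub, PowerSeries.derivative_one,
    sub_zero]
  linear_combination -(PowerSeries.derivative ℚ F) * h2

/-- Compare coefficients in `z F' = F · z G'`; this is the recursion behind the exponential formula.
-/
theorem HasLog.coeff_mul {F G : ℚ⟦X⟧} (h : HasLog F G) (n : ℕ) :
    n * coeff n F = ∑ p ∈ Finset.HasAntidiagonal.antidiagonal n, coeff p.1 F * (p.2 * coeff p.2 G) := by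
  have key : ∀ H : ℚ⟦X⟧, ∀ n : ℕ, coeff n (X * PowerSeries.derivative ℚ H) = n * coeff n H := by
    intro H n
    rcases n with _ | n
    · simp
    · rw [coeff_succ_X_mul, PowerSeries.coeff_derivative]
      push_cast
      ring
  rw [← key, h, mul_left_comm, PowerSeries.coeff_mul]
  refine Finset.sum_congr rfl fun p _ => ?_
  rw [key]

/-! ### The series `sinh z / z` -/

theorem coeff_sinhSeries (n : ℕ) :
    coeff n sinhSeries = 1 / 2 * (1 - (-1) ^ n) / (n.factorial : ℚ) := by
  rw [sinhSeries, coeff_C_mul, map_sub, coeff_rescale, coeff_exp]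
  simp
  ring

theorem constantCoeff_sinhc : constantCoeff sinhc = 1 := by
  rw [← coeff_zero_eq_constantCoeff_apply, sinhc, coeff_mk, coeff_sinhSeries]
  norm_num

theorem rescale_neg_one_sinhc : rescale (-1 : ℚ) sinhc = sinhc := by
  ext n
  rw [coeff_rescale, sinhc, coeff_mk, coeff_sinhSeries]
  rcases Nat.even_or_odd n with h | h
  · rw [h.neg_one_pow, one_mul]
  · rw [h.add_one.neg_one_pow]
    simp

/-- `sinhc` is even, and a logarithm is determined by its derivative and its constant term, hence is
even too. -/
theorem xi_odd {n : ℕ} (hn : Odd n) : xi n = 0 := by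
  have h1 := hasLog_logOf constantCoeff_sinhc
  have h2 := h1.rescale (-1)
  rw [rescale_neg_one_sinhc] at h2
  have hne : sinhc ≠ 0 := by
    intro h
    have := constantCoeff_sinhc
    rw [h, map_zero] at this
    exact zero_ne_one this
  have h3 : rescale (-1 : ℚ) (logOf sinhc) = logOf sinhc := by
    refine PowerSeries.derivative.ext (mul_left_cancel₀ hne (h2.symm.trans h1)) ?_
    rw [← coeff_zero_eq_constantCoeff_apply, coeff_rescale, pow_zero, one_mul,
      coeff_zero_eq_constantCoeff_apply]
  have h4 := congrArg (coeff n) h3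
  rw [coeff_rescale, hn.neg_one_pow] at h4
  rw [xi]
  linarith

/-- The power series `sinh (iz/2) / (iz/2)`. -/
def sinhcHalf (i : ℕ) : ℚ⟦X⟧ := rescale ((i : ℚ) / 2) sinhc

theorem constantCoeff_sinhcHalf (i : ℕ) : constantCoeff (sinhcHalf i) = 1 := by
  rw [sinhcHalf, ← coeff_zero_eq_constantCoeff_apply, coeff_rescale, pow_zero, one_mul,
    coeff_zero_eq_constantCoeff_apply, constantCoeff_sinhc]

theorem X_mul_sinhcHalf (i : ℕ) : C (i : ℚ) * (X * sinhcHalf i) =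
    rescale ((i : ℚ) / 2) (exp ℚ) - rescale (-((i : ℚ) / 2)) (exp ℚ) := by
  ext n
  rw [coeff_C_mul]
  rcases n with _ | n
  · rw [coeff_zero_X_mul, mul_zero, map_sub, coeff_rescale, coeff_rescale, pow_zero, pow_zero,
      sub_self]
  · rw [coeff_succ_X_mul, sinhcHalf, coeff_rescale, sinhc, coeff_mk, coeff_sinhSeries, map_sub,
      coeff_rescale, coeff_rescale, neg_pow ((i : ℚ) / 2), coeff_exp]
    simp only [Algebra.algebraMap_self, RingHom.id_apply]
    rw [pow_succ ((i : ℚ) / 2)]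
    ring

/-- The power series `∏_i (sinh (iz/2) / (iz/2))^{c_i}`. -/
def sinhProductSeries {d : ℕ} (β : d.Partition) : ℚ⟦X⟧ :=
  (β.parts.map sinhcHalf).prod * (sinhcHalf 1)⁻¹

theorem mem_Icc_of_mem_parts {d : ℕ} (β : d.Partition) {i : ℕ} (hi : i ∈ β.parts) :
    i ∈ Finset.Icc 1 d := by
  rw [Finset.mem_Icc]
  refine ⟨β.parts_pos hi, ?_⟩
  conv_rhs => rw [← β.parts_sum]
  exact Multiset.single_le_sum (fun _ _ => Nat.zero_le _) _ hi

/-- The only inverse needed is that of the factor `i = 1`, whose constant term is `1`, so it already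
exists among power series. -/
theorem sinhProduct_eq {d : ℕ} (hd : 0 < d) (β : d.Partition) :
    sinhProduct β = ((sinhProductSeries β : ℚ⟦X⟧) : LaurentSeries ℚ) := by
  have hne : ∀ i : ℕ, ((sinhcHalf i : ℚ⟦X⟧) : LaurentSeries ℚ) ≠ 0 := by
    intro i h
    have h1 : sinhcHalf i = 0 := by
      apply HahnSeries.ofPowerSeries_injective (Γ := ℤ)
      rw [map_zero]
      exact h
    have h2 := constantCoeff_sinhcHalf i
    rw [h1, map_zero] at h2
    exact zero_ne_one h2
  have h1 : sinhProduct β = (∏ i ∈ Finset.Icc 1 d,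
      ((sinhcHalf i : ℚ⟦X⟧) : LaurentSeries ℚ) ^ β.parts.count i) *
      (((sinhcHalf 1 : ℚ⟦X⟧) : LaurentSeries ℚ))⁻¹ := by
    have h2 : (((sinhcHalf 1 : ℚ⟦X⟧) : LaurentSeries ℚ))⁻¹ = ∏ i ∈ Finset.Icc 1 d,
        if i = 1 then (((sinhcHalf 1 : ℚ⟦X⟧) : LaurentSeries ℚ))⁻¹ else 1 := by
      rw [Finset.prod_ite_eq', if_pos (Finset.mem_Icc.2 ⟨le_rfl, hd⟩)]
    rw [h2, ← Finset.prod_mul_distrib, sinhProduct]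
    refine Finset.prod_congr rfl fun i _ => ?_
    change ((sinhcHalf i : ℚ⟦X⟧) : LaurentSeries ℚ) ^ cExp β i = _
    rw [cExp, zpow_sub₀ (hne i), zpow_natCast, div_eq_mul_inv]
    split_ifs with hi
    · rw [zpow_one, hi]
    · rw [zpow_zero, inv_one]
  have h3 : (((sinhcHalf 1)⁻¹ : ℚ⟦X⟧) : LaurentSeries ℚ) =
      (((sinhcHalf 1 : ℚ⟦X⟧) : LaurentSeries ℚ))⁻¹ := by
    apply eq_inv_of_mul_eq_one_left
    rw [← map_mul, PowerSeries.inv_mul_cancel, map_one]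
    rw [constantCoeff_sinhcHalf]
    exact one_ne_zero
  rw [h1, sinhProductSeries, map_mul, h3, Finset.prod_multiset_map_count, map_prod]
  congr 1
  simp_rw [map_pow]
  refine (Finset.prod_subset ?_ ?_).symm
  · intro i hi
    exact mem_Icc_of_mem_parts β (Multiset.mem_toFinset.1 hi)
  · intro i _ hi
    rw [Multiset.count_eq_zero.2 (fun h => hi (Multiset.mem_toFinset.2 h)), pow_zero]

/-! ### The hook polynomial at `q = -e^z` -/

theorem rescale_exp_mul (a b : ℚ) :
    rescale a (exp ℚ) * rescale b (exp ℚ) = rescale (a + b) (exp ℚ) :=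
  exp_mul_exp_eq_exp_add a b

theorem rescale_exp_pow (n : ℕ) : exp ℚ ^ n = rescale (n : ℚ) (exp ℚ) :=
  exp_pow_eq_rescale_exp n

/-- Part by part: `e^{-bz/2} (1 - e^{bz}) = -(e^{bz/2} - e^{-bz/2}) = -b z · sinhcHalf b`. -/
theorem prod_exp_half {m : Multiset ℕ} :
    rescale (-((m.sum : ℚ) / 2)) (exp ℚ) * (m.map fun b => 1 - exp ℚ ^ b).prod =
      (-X) ^ m.card * C (m.prod : ℚ) * (m.map sinhcHalf).prod := by
  induction m using Multiset.induction_on with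
  | empty =>
    simp only [Multiset.sum_zero, Multiset.map_zero, Multiset.prod_zero, Multiset.card_zero]
    ext n
    simp [coeff_one]
  | cons a m ih =>
    simp only [Multiset.sum_cons, Multiset.map_cons, Multiset.prod_cons, Multiset.card_cons]
    have h1 : rescale (-(((a + m.sum : ℕ) : ℚ) / 2)) (exp ℚ) =
        rescale (-((a : ℚ) / 2)) (exp ℚ) * rescale (-((m.sum : ℚ) / 2)) (exp ℚ) := by
      rw [rescale_exp_mul]
      congr 2
      push_cast
      ring
    have h2 : rescale (-((a : ℚ) / 2)) (exp ℚ) * exp ℚ ^ a = rescale ((a : ℚ) / 2) (exp ℚ) := by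
      rw [rescale_exp_pow, rescale_exp_mul]
      congr 2
      ring
    have h3 := X_mul_sinhcHalf a
    rw [h1]
    have h4 : C ((a * m.prod : ℕ) : ℚ) = C (a : ℚ) * C (m.prod : ℚ) := by
      rw [← map_mul, Nat.cast_mul]
    rw [h4, pow_succ]
    linear_combination (rescale (-((a : ℚ) / 2)) (exp ℚ)) * (1 - exp ℚ ^ a) * ih -
      ((-X) ^ m.card * C (m.prod : ℚ) * (m.map sinhcHalf).prod) * h2 +
      ((-X) ^ m.card * C (m.prod : ℚ) * (m.map sinhcHalf).prod) * h3

/-- Substitute `q = -e^z` in the product formula. The factor `1 + q` becomes `1 - e^z = -e^{z/2} z ·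
sinhcHalf 1`; this accounts for the inverse factor, the lost power of `X` and the shift from `d` to
`d - 1`. Its sign cancels `(-1)^n` because `n` is odd. -/
theorem exp_mul_aeval_hookPoly {d : ℕ} (hd : 0 < d) (β : d.Partition) (hβ : Odd (len β))
    {σ : Perm (Fin d)} (hσ : σ.partition.parts = β.parts) :
    rescale (-(((d : ℚ) - 1) / 2)) (exp ℚ) * Polynomial.aeval (-exp ℚ) (hookPoly σ) =
      X ^ (len β - 1) * C (β.parts.prod : ℚ) * sinhProductSeries β := by
  have : Nonempty (Fin d) := ⟨⟨0, hd⟩⟩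
  have h1 := congrArg (Polynomial.aeval (-exp ℚ)) (one_add_X_mul_hookPoly σ)
  rw [map_mul, map_add, map_one, Polynomial.aeval_X, map_multiset_prod, Multiset.map_map,
    hσ] at h1
  have h2 : (β.parts.map (⇑(Polynomial.aeval (-exp ℚ)) ∘
      fun b => (1 - (-Polynomial.X) ^ b : Polynomial ℚ))) =
      β.parts.map fun b => 1 - exp ℚ ^ b := by
    refine Multiset.map_congr rfl fun b _ => ?_
    simp
  rw [h2] at h1
  have h3 := prod_exp_half (m := β.parts)
  rw [β.parts_sum, ← h1] at h3
  obtain ⟨n, hn⟩ : ∃ n, len β = n + 1 := ⟨len β - 1, by have := hβ.pos; omega⟩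
  have hn' : β.parts.card = n + 1 := hn
  rw [hn'] at h3
  have h4 : (-X : ℚ⟦X⟧) ^ (n + 1) = -(X * X ^ n) := by
    rw [hn] at hβ
    rw [hβ.neg_pow, pow_succ']
  have h5 := X_mul_sinhcHalf 1
  have h6 : rescale (-((d : ℚ) / 2)) (exp ℚ) = rescale (-(((1 : ℕ) : ℚ) / 2)) (exp ℚ) *
      rescale (-(((d : ℚ) - 1) / 2)) (exp ℚ) := by
    rw [rescale_exp_mul]
    congr 2
    push_cast
    ring
  have h7 : rescale (-(((1 : ℕ) : ℚ) / 2)) (exp ℚ) * exp ℚ =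
      rescale (((1 : ℕ) : ℚ) / 2) (exp ℚ) := by
    have := rescale_exp_mul (-(((1 : ℕ) : ℚ) / 2)) 1
    rw [rescale_one, RingHom.id_apply] at this
    rw [this]
    congr 2
    norm_num
  have hC : C ((1 : ℕ) : ℚ) = (1 : ℚ⟦X⟧) := by simp
  rw [hC, one_mul] at h5
  rw [h6, h4] at h3
  have hinv : sinhcHalf 1 * (sinhcHalf 1)⁻¹ = 1 :=
    PowerSeries.mul_inv_cancel _ (by rw [constantCoeff_sinhcHalf]; exact one_ne_zero)
  have hne : X * sinhcHalf 1 ≠ 0 := by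
    refine mul_ne_zero X_ne_zero fun h => ?_
    rw [h, zero_mul] at hinv
    exact zero_ne_one hinv
  apply mul_left_cancel₀ hne
  rw [hn, Nat.add_sub_cancel, sinhProductSeries]
  generalize rescale (-(((d : ℚ) - 1) / 2)) (exp ℚ) = u at *
  generalize Polynomial.aeval (-exp ℚ) (hookPoly σ) = v at *
  linear_combination -h3 - u * v * h7 + u * v * h5 -
    X * X ^ n * C (β.parts.prod : ℚ) * (β.parts.map sinhcHalf).prod * hinv

/-- The left side of `exp_mul_aeval_hookPoly` is a combination of exponentials `e^{(k - (d-1)/2)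
z}`, hence an exponential generating function of these moments. -/
theorem sum_pow_mul_coeff_hookPoly {d : ℕ} (hd : 0 < d) (β : d.Partition) (hβ : Odd (len β))
    {σ : Perm (Fin d)} (hσ : σ.partition.parts = β.parts) (n : ℕ) :
    ∑ k ∈ Finset.range d, (-1) ^ k * ((k : ℚ) - (d - 1) / 2) ^ n * (hookPoly σ).coeff k =
      n.factorial * (β.parts.prod : ℚ) *
        coeff n (X ^ (len β - 1) * sinhProductSeries β) := by
  have h1 := congrArg (coeff n) (exp_mul_aeval_hookPoly hd β hβ hσ)
  have h2 : rescale (-(((d : ℚ) - 1) / 2)) (exp ℚ) * Polynomial.aeval (-exp ℚ) (hookPoly σ) =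
      ∑ k ∈ Finset.range d, C ((-1) ^ k * (hookPoly σ).coeff k) *
        rescale ((k : ℚ) - (d - 1) / 2) (exp ℚ) := by
    simp_rw [coeff_hookPoly]
    rw [hookPoly, map_sum, Fintype.card_fin, Finset.mul_sum]
    refine Finset.sum_congr rfl fun k _ => ?_
    have h4 : rescale ((k : ℚ) - (d - 1) / 2) (exp ℚ) =
        rescale (-(((d : ℚ) - 1) / 2)) (exp ℚ) * exp ℚ ^ k := by
      rw [rescale_exp_pow, rescale_exp_mul]
      congr 2
      ring
    have h5 : Polynomial.aeval (-exp ℚ) (Polynomial.C (hookChar k σ)) = C (hookChar k σ) :=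
      Polynomial.aeval_C _ _
    rw [h4, map_mul, h5, map_pow, Polynomial.aeval_X, neg_pow, map_mul, map_pow, map_neg, map_one]
    ring
  rw [h2, mul_right_comm, mul_comm _ (C _), coeff_C_mul, map_sum] at h1
  rw [mul_assoc, ← h1, Finset.mul_sum]
  refine Finset.sum_congr rfl fun k _ => ?_
  rw [coeff_C_mul, coeff_rescale, coeff_exp]
  simp only [Algebra.algebraMap_self, RingHom.id_apply]
  field_simp

/-! ### The exponential formula for partitions -/

/-- `∏ a_p / ∏ m_i!`, where `p` runs over a multiset in which `i` has multiplicity `m_i`. -/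
def multisetWeight (a : ℕ → ℚ) (m : Multiset ℕ) : ℚ :=
  (m.map a).prod / ((∏ i ∈ m.toFinset, (m.count i).factorial : ℕ) : ℚ)

theorem prod_factorial_count_cons (j : ℕ) (m : Multiset ℕ) :
    ∏ i ∈ (j ::ₘ m).toFinset, ((j ::ₘ m).count i).factorial =
      (m.count j + 1) * ∏ i ∈ m.toFinset, (m.count i).factorial := by
  have h1 : ∏ i ∈ m.toFinset, (m.count i).factorial =
      ∏ i ∈ (j ::ₘ m).toFinset, (m.count i).factorial := by
    refine Finset.prod_subset ?_ ?_
    · rw [Multiset.toFinset_cons]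
      exact Finset.subset_insert _ _
    · intro i _ hi
      rw [Multiset.count_eq_zero.2 (fun h => hi (Multiset.mem_toFinset.2 h)), Nat.factorial_zero]
  have hj : j ∈ (j ::ₘ m).toFinset := by simp
  rw [h1, ← Finset.mul_prod_erase _ _ hj, ← Finset.mul_prod_erase _ _ hj, ← mul_assoc,
    Multiset.count_cons_self, Nat.factorial_succ]
  congr 1
  refine Finset.prod_congr rfl fun i hi => ?_
  rw [Multiset.count_cons_of_ne (Finset.ne_of_mem_erase hi)]

theorem count_mul_multisetWeight_cons (a : ℕ → ℚ) (j : ℕ) (m : Multiset ℕ) :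
    ((j ::ₘ m).count j : ℚ) * multisetWeight a (j ::ₘ m) = a j * multisetWeight a m := by
  have h : ((∏ i ∈ m.toFinset, (m.count i).factorial : ℕ) : ℚ) ≠ 0 := by
    rw [Nat.cast_ne_zero]
    exact Finset.prod_ne_zero_iff.2 fun i _ => Nat.factorial_ne_zero _
  rw [multisetWeight, multisetWeight, prod_factorial_count_cons, Multiset.map_cons,
    Multiset.prod_cons, Multiset.count_cons_self]
  push_cast at h ⊢
  have h2 : (m.count j : ℚ) + 1 ≠ 0 := by positivity
  field_simp

/-- The sum of the weights of all partitions of `n`. -/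
def partitionSum (a : ℕ → ℚ) (n : ℕ) : ℚ :=
  ∑ lam : n.Partition, multisetWeight a lam.parts

theorem partitionSum_zero (a : ℕ → ℚ) : partitionSum a 0 = 1 := by
  rw [partitionSum, Fintype.sum_unique, Nat.Partition.partition_zero_parts, multisetWeight]
  simp

/-- Removing one part `j` is a bijection from partitions of `n` containing `j` to partitions of `n -
j`; the multiplicity weight absorbs the change in automorphisms. -/
theorem sum_count_mul_multisetWeight (a : ℕ → ℚ) {n j : ℕ} (hj : 0 < j) (hjn : j ≤ n) :
    ∑ lam : n.Partition, (lam.parts.count j : ℚ) * multisetWeight a lam.parts =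
      a j * partitionSum a (n - j) := by
  classical
  rw [partitionSum, Finset.mul_sum]
  rw [← Finset.sum_filter_add_sum_filter_not Finset.univ (fun lam : n.Partition => j ∈ lam.parts)]
  rw [Finset.sum_eq_zero (s := {lam : n.Partition | ¬ j ∈ lam.parts}), add_zero]
  · refine Finset.sum_bij' (fun lam hlam => ⟨lam.parts.erase j, fun hi =>
        lam.parts_pos (Multiset.mem_of_mem_erase hi), ?_⟩)
      (fun nu _ => ⟨j ::ₘ nu.parts, fun {i} hi => ?_, ?_⟩) ?_ ?_ ?_ ?_ ?_
    · have h := Multiset.sum_erase (Finset.mem_filter.1 hlam).2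
      rw [lam.parts_sum] at h
      omega
    · rcases Multiset.mem_cons.1 hi with rfl | hi
      · exact hj
      · exact nu.parts_pos hi
    · rw [Multiset.sum_cons, nu.parts_sum]
      omega
    · intro lam hlam
      exact Finset.mem_univ _
    · intro nu _
      rw [Finset.mem_filter]
      exact ⟨Finset.mem_univ _, Multiset.mem_cons_self _ _⟩
    · intro lam hlam
      apply Nat.Partition.ext
      exact Multiset.cons_erase (Finset.mem_filter.1 hlam).2
    · intro nu _
      apply Nat.Partition.ext
      exact Multiset.erase_cons_head _ _
    · intro lam hlam
      rw [← count_mul_multisetWeight_cons, Multiset.cons_erase (Finset.mem_filter.1 hlam).2]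
  · intro lam hlam
    rw [Multiset.count_eq_zero.2 (Finset.mem_filter.1 hlam).2, Nat.cast_zero, zero_mul]

/-- Write `n = ∑ j m_j` inside the sum and remove a part `j` from each term. -/
theorem mul_partitionSum (a : ℕ → ℚ) (n : ℕ) :
    n * partitionSum a n = ∑ p ∈ Finset.HasAntidiagonal.antidiagonal n,
      partitionSum a p.1 * (p.2 * a p.2) := by
  have h1 : ∀ lam : n.Partition, (n : ℚ) =
      ∑ j ∈ Finset.range (n + 1), (j : ℚ) * lam.parts.count j := by
    intro lam
    have h2 : lam.parts.sum = ∑ j ∈ Finset.range (n + 1), lam.parts.count j • j := by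
      rw [Finset.sum_multiset_count]
      refine Finset.sum_subset ?_ ?_
      · intro i hi
        have := Finset.mem_Icc.1 (mem_Icc_of_mem_parts lam (Multiset.mem_toFinset.1 hi))
        rw [Finset.mem_range]
        omega
      · intro i _ hi
        rw [Multiset.count_eq_zero.2 (fun h => hi (Multiset.mem_toFinset.2 h)), zero_smul]
    rw [lam.parts_sum] at h2
    have h3 := congrArg (Nat.cast : ℕ → ℚ) h2
    push_cast at h3
    rw [h3]
    refine Finset.sum_congr rfl fun j _ => ?_
    rw [smul_eq_mul]
    push_cast
    ring
  rw [partitionSum, Finset.mul_sum]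
  have h4 : ∀ lam : n.Partition, n * multisetWeight a lam.parts =
      ∑ j ∈ Finset.range (n + 1), (j : ℚ) * (lam.parts.count j * multisetWeight a lam.parts) := by
    intro lam
    conv_lhs => rw [h1 lam, Finset.sum_mul]
    refine Finset.sum_congr rfl fun j _ => ?_
    ring
  rw [Finset.sum_congr rfl fun lam _ => h4 lam, Finset.sum_comm,
    ← Finset.Nat.sum_antidiagonal_swap, Finset.Nat.sum_antidiagonal_eq_sum_range_succ_mk]
  refine Finset.sum_congr rfl fun j hj => ?_
  rw [Finset.mem_range] at hj
  simp only [Prod.fst_swap, Prod.snd_swap]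
  rw [← Finset.mul_sum]
  rcases Nat.eq_zero_or_pos j with rfl | hj'
  · simp
  · rw [sum_count_mul_multisetWeight a hj' (by omega)]
    ring

/-- A sequence satisfying the recurrence of the exponential formula is given by partition sums. -/
theorem eq_partitionSum (a q : ℕ → ℚ) (h0 : q 0 = 1)
    (h : ∀ n : ℕ, n * q n = ∑ p ∈ Finset.HasAntidiagonal.antidiagonal n,
      q p.1 * (p.2 * a p.2)) (n : ℕ) : q n = partitionSum a n := by
  induction n using Nat.strong_induction_on with
  | _ n ih =>
    rcases Nat.eq_zero_or_pos n with rfl | hn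
    · rw [h0, partitionSum_zero]
    · have hn' : (n : ℚ) ≠ 0 := by exact_mod_cast hn.ne'
      apply mul_left_cancel₀ hn'
      rw [h, mul_partitionSum]
      refine Finset.sum_congr rfl fun p hp => ?_
      rw [Finset.HasAntidiagonal.mem_antidiagonal] at hp
      -- The term `p.2 = 0` involves index `n` itself, out of reach of induction, but carries the
      -- factor zero.
      rcases Nat.eq_zero_or_pos p.2 with h2 | h2
      · rw [h2]
        simp
      · rw [ih p.1 (by omega)]

/-! ### Partition expansion of the sinh product -/

/-- The formal logarithm of `∏_i (sinh (iz/2) / (iz/2))^{c_i}`. -/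
def sinhProductLog {d : ℕ} (β : d.Partition) : ℚ⟦X⟧ :=
  (β.parts.map fun i : ℕ => rescale ((i : ℚ) / 2) (logOf sinhc)).sum +
    -rescale (((1 : ℕ) : ℚ) / 2) (logOf sinhc)

theorem hasLog_sinhProductSeries {d : ℕ} (β : d.Partition) :
    HasLog (sinhProductSeries β) (sinhProductLog β) := by
  have h : ∀ i, HasLog (sinhcHalf i) (rescale ((i : ℚ) / 2) (logOf sinhc)) := fun i =>
    (hasLog_logOf constantCoeff_sinhc).rescale _
  exact (HasLog.multiset_prod β.parts h).mul ((h 1).inv (by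
    rw [constantCoeff_sinhcHalf]
    exact one_ne_zero))

theorem powS_eq {d : ℕ} (hd : 0 < d) (β : d.Partition) (j : ℕ) :
    powS β j = (β.parts.map fun i : ℕ => (i : ℚ) ^ j).sum - 1 := by
  have h1 : (β.parts.map fun i : ℕ => (i : ℚ) ^ j).sum =
      ∑ k ∈ Finset.Icc 1 d, (k : ℚ) ^ j * β.parts.count k := by
    rw [Finset.sum_multiset_map_count]
    simp_rw [nsmul_eq_mul, mul_comm]
    refine Finset.sum_subset ?_ ?_
    · intro i hi
      exact mem_Icc_of_mem_parts β (Multiset.mem_toFinset.1 hi)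
    · intro i _ hi
      rw [Multiset.count_eq_zero.2 (fun h => hi (Multiset.mem_toFinset.2 h)), Nat.cast_zero,
        mul_zero]
  have h2 : (1 : ℚ) = ∑ k ∈ Finset.Icc 1 d, if k = 1 then 1 else 0 := by
    rw [Finset.sum_ite_eq', if_pos (Finset.mem_Icc.2 ⟨le_rfl, hd⟩)]
  rw [h1]
  conv_rhs => rw [h2]
  rw [← Finset.sum_sub_distrib, powS]
  refine Finset.sum_congr rfl fun k _ => ?_
  rw [cExp]
  split_ifs with hk
  · rw [hk]
    push_cast
    ring
  · push_cast
    ring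

theorem coeff_sinhProductLog {d : ℕ} (hd : 0 < d) (β : d.Partition) (n : ℕ) :
    coeff n (sinhProductLog β) = xi n * powS β n / 2 ^ n := by
  have h : ∀ m : Multiset ℕ,
      coeff n (m.map fun i : ℕ => rescale ((i : ℚ) / 2) (logOf sinhc)).sum =
      (m.map fun i : ℕ => (i : ℚ) ^ n).sum * xi n / 2 ^ n := by
    intro m
    induction m using Multiset.induction_on with
    | empty => simp
    | cons a m ih =>
      rw [Multiset.map_cons, Multiset.sum_cons, map_add, ih, coeff_rescale, Multiset.map_cons,
        Multiset.sum_cons, xi, div_pow]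
      ring
  rw [sinhProductLog, map_add, map_neg, h, coeff_rescale, powS_eq hd, xi, div_pow]
  push_cast
  ring

theorem sum_antidiagonal_two_mul (n : ℕ) (f : ℕ → ℕ → ℚ)
    (hf : ∀ i j, Odd j → f i j = 0) :
    ∑ p ∈ Finset.HasAntidiagonal.antidiagonal (2 * n), f p.1 p.2 =
      ∑ p ∈ Finset.HasAntidiagonal.antidiagonal n, f (2 * p.1) (2 * p.2) := by
  symm
  refine Finset.sum_bij_ne_zero (fun p _ _ => (2 * p.1, 2 * p.2)) ?_ ?_ ?_ ?_
  · intro p hp _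
    rw [Finset.HasAntidiagonal.mem_antidiagonal] at hp ⊢
    simp only
    omega
  · intro p _ _ q _ _ h
    simp only [Prod.mk.injEq] at h
    exact Prod.ext (by omega) (by omega)
  · intro p hp hne
    rw [Finset.HasAntidiagonal.mem_antidiagonal] at hp
    have h2 : Even p.2 := by
      rw [← Nat.not_odd_iff_even]
      exact fun h => hne (hf _ _ h)
    obtain ⟨j, hj⟩ := h2
    have h1 : (2 * (n - j), 2 * j) = p := Prod.ext (by simp only; omega) (by simp only; omega)
    refine ⟨(n - j, j), ?_, ?_, h1⟩
    · rw [Finset.HasAntidiagonal.mem_antidiagonal]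
      simp only
      omega
    · rw [← h1] at hne
      exact hne
  · intro p _ _
    rfl

/-- The even coefficients of `∏_i (sinh (iz/2) / (iz/2))^{c_i}` as sums over partitions. -/
theorem coeff_sinhProductSeries {d : ℕ} (hd : 0 < d) (β : d.Partition) (n : ℕ) :
    coeff (2 * n) (sinhProductSeries β) = (∑ lam : n.Partition,
      xiTwo lam * powSTwo β lam / (autCard lam : ℚ)) / 2 ^ (2 * n) := by
  have h0 : coeff 0 (sinhProductSeries β) = 1 := by
    rw [coeff_zero_eq_constantCoeff_apply, sinhProductSeries, map_mul,
      PowerSeries.constantCoeff_inv, constantCoeff_sinhcHalf, inv_one, mul_one, map_multiset_prod,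
      Multiset.map_map]
    refine Multiset.prod_eq_one fun x hx => ?_
    obtain ⟨i, _, rfl⟩ := Multiset.mem_map.1 hx
    exact constantCoeff_sinhcHalf i
  have h1 := eq_partitionSum (fun j => coeff (2 * j) (sinhProductLog β))
    (fun j => coeff (2 * j) (sinhProductSeries β)) h0 (by
      intro m
      have h2 := (hasLog_sinhProductSeries β).coeff_mul (2 * m)
      -- The logarithm has no odd coefficients, so the recursion at `2 * m` closes on even indices;
      -- the factor `2` then cancels from both sides.
      rw [sum_antidiagonal_two_mul m (fun i j => coeff i (sinhProductSeries β) *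
        (j * coeff j (sinhProductLog β)))] at h2
      · push_cast at h2
        have h3 : (2 : ℚ) * (m * coeff (2 * m) (sinhProductSeries β)) =
            2 * ∑ p ∈ Finset.HasAntidiagonal.antidiagonal m,
              coeff (2 * p.1) (sinhProductSeries β) *
                (p.2 * coeff (2 * p.2) (sinhProductLog β)) := by
          rw [← mul_assoc, h2, Finset.mul_sum]
          refine Finset.sum_congr rfl fun p _ => ?_
          ring
        exact mul_left_cancel₀ two_ne_zero h3
      · intro i j hj
        rw [coeff_sinhProductLog hd, xi_odd hj]
        simp) n
  rw [h1, partitionSum, Finset.sum_div]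
  refine Finset.sum_congr rfl fun lam _ => ?_
  have h4 : ∀ m : Multiset ℕ, (m.map fun j => coeff (2 * j) (sinhProductLog β)).prod =
      (m.map fun j => xi (2 * j)).prod * (m.map fun j => powS β (2 * j)).prod /
        2 ^ (2 * m.sum) := by
    intro m
    induction m using Multiset.induction_on with
    | empty => simp
    | cons a m ih =>
      rw [Multiset.map_cons, Multiset.map_cons, Multiset.map_cons, Multiset.prod_cons,
        Multiset.prod_cons, Multiset.prod_cons, ih, coeff_sinhProductLog hd, Multiset.sum_cons,
        mul_add, pow_add]
      field_simp
  rw [multisetWeight, h4, lam.parts_sum, xiTwo, powSTwo, autCard]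
  ring

/-! ### The explicit formulae -/

theorem doubleHurwitz_eq_sum_coeff {d : ℕ} (hd : 0 < d) (g s : ℕ) (β : d.Partition)
    (hβ : Odd (len β)) (hs : (2 * s : ℤ) = 2 * g - 1 + len β) :
    doubleHurwitz g 2 (Nat.Partition.indiscrete d) β =
      (s.factorial : ℚ) * (d : ℚ) ^ ((s : ℤ) - 1) / 2 ^ s *
        ∑ h ∈ Finset.range (g + 1), ((2 * s - 2 * h).factorial : ℚ) /
          ((h.factorial : ℚ) * ((s - h).factorial : ℚ) * 12 ^ h) * (d : ℚ) ^ (2 * h) *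
          coeff (2 * (g - h)) (sinhProductSeries β) := by
  have hlen := hβ.pos
  have hσ : (permOfPartition β)⁻¹.partition.parts = β.parts := by
    rw [parts_partition_inv, parts_partition_permOfPartition]
  have hprod : (β.parts.prod : ℚ) ≠ 0 := by
    rw [Nat.cast_ne_zero]
    exact Multiset.prod_ne_zero fun h => (β.parts_pos h).ne rfl
  rw [doubleHurwitz_eq_sum_hooks hd g s β hs]
  have h1 : ∑ k ∈ Finset.range d, (-1) ^ k * (((k : ℚ) - (d - 1) / 2) ^ 2 + d ^ 2 / 12) ^ s *
      (hookPoly (permOfPartition β)⁻¹).coeff k =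
      ∑ h ∈ Finset.range (s + 1), ((d : ℚ) ^ 2 / 12) ^ h * (s.choose h : ℚ) *
        (((2 * s - 2 * h).factorial : ℚ) * (β.parts.prod : ℚ) *
          coeff (2 * s - 2 * h) (X ^ (len β - 1) * sinhProductSeries β)) := by
    simp_rw [← sum_pow_mul_coeff_hookPoly hd β hβ hσ, Finset.mul_sum]
    rw [Finset.sum_comm]
    refine Finset.sum_congr rfl fun k _ => ?_
    rw [add_comm (((k : ℚ) - (d - 1) / 2) ^ 2), add_pow, Finset.mul_sum, Finset.sum_mul]
    refine Finset.sum_congr rfl fun h _ => ?_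
    rw [← pow_mul, Nat.mul_sub]
    ring
  have h2 : ∑ h ∈ Finset.range (s + 1), ((d : ℚ) ^ 2 / 12) ^ h * (s.choose h : ℚ) *
        (((2 * s - 2 * h).factorial : ℚ) * (β.parts.prod : ℚ) *
          coeff (2 * s - 2 * h) (X ^ (len β - 1) * sinhProductSeries β)) =
      ∑ h ∈ Finset.range (g + 1), ((d : ℚ) ^ 2 / 12) ^ h * (s.choose h : ℚ) *
        (((2 * s - 2 * h).factorial : ℚ) * (β.parts.prod : ℚ) *
          coeff (2 * (g - h)) (sinhProductSeries β)) := by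
    -- For `h > g` the degree `2s - 2h` is below `n - 1`, so the factor `X^(n-1)` kills the
    -- coefficient; for `h ≤ g` it equals `2(g - h) + (n - 1)`.
    rw [← Finset.sum_subset (Finset.range_mono (show g + 1 ≤ s + 1 by omega))]
    · refine Finset.sum_congr rfl fun h hh => ?_
      rw [Finset.mem_range] at hh
      have e : 2 * s - 2 * h = 2 * (g - h) + (len β - 1) := by omega
      rw [mul_comm (X ^ _), e, coeff_mul_X_pow]
    · intro h hh hh'
      rw [Finset.mem_range] at hh hh'
      rw [coeff_X_pow_mul', if_neg (by omega), mul_zero, mul_zero]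
  rw [h1, h2, Finset.mul_sum, Finset.mul_sum]
  refine Finset.sum_congr rfl fun h hh => ?_
  rw [Finset.mem_range] at hh
  rw [Nat.cast_choose ℚ (show h ≤ s by omega), div_pow, ← pow_mul]
  field_simp

end Hurwitz

end

theorem theorem1p2 (g d : ℕ) (hd : 0 < d) (β : d.Partition) (hβ : Odd (Hurwitz.len β))
    (s : ℕ) (hs : (2 * s : ℤ) = 2 * g - 1 + Hurwitz.len β) :
    Hurwitz.doubleHurwitz g 2 (Nat.Partition.indiscrete d) β =
        (s.factorial : ℚ) * (d : ℚ) ^ ((s : ℤ) - 1) / 2 ^ s *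
          ∑ h ∈ Finset.range (g + 1),
            ((2 * s - 2 * h).factorial : ℚ) /
              ((h.factorial : ℚ) * ((s - h).factorial : ℚ) * 12 ^ h) * (d : ℚ) ^ (2 * h) *
              (Hurwitz.sinhProduct β).coeff (2 * ((g : ℤ) - (h : ℤ))) ∧
      Hurwitz.doubleHurwitz g 2 (Nat.Partition.indiscrete d) β =
        (s.factorial : ℚ) * (d : ℚ) ^ ((s : ℤ) - 1) / 2 ^ (s + 2 * g) *
          ∑ h ∈ Finset.range (g + 1),
            ((2 * s - 2 * h).factorial : ℚ) /
              ((h.factorial : ℚ) * ((s - h).factorial : ℚ) * 3 ^ h) * (d : ℚ) ^ (2 * h) *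
              ∑ lam : (g - h).Partition,
                Hurwitz.xiTwo lam * Hurwitz.powSTwo β lam / (Hurwitz.autCard lam : ℚ) := by
  rw [Hurwitz.doubleHurwitz_eq_sum_coeff hd g s β hβ hs]
  constructor
  · congr 1
    refine Finset.sum_congr rfl fun h hh => ?_
    rw [Finset.mem_range] at hh
    have e : 2 * ((g : ℤ) - (h : ℤ)) = ((2 * (g - h) : ℕ) : ℤ) := by omega
    rw [Hurwitz.sinhProduct_eq hd, e, LaurentSeries.coeff_coe_powerSeries]
  · rw [Finset.mul_sum, Finset.mul_sum]
    refine Finset.sum_congr rfl fun h hh => ?_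
    rw [Finset.mem_range] at hh
    rw [Hurwitz.coeff_sinhProductSeries hd]
    -- The `2^{2h}` in `12^h` and the `2^{2(g-h)}` from the halved arguments combine to `2^{2g}`,
    -- independent of `h`.
    have e1 : (12 : ℚ) ^ h = 3 ^ h * 2 ^ (2 * h) := by
      rw [pow_mul, ← mul_pow]
      norm_num
    have e2 : (2 : ℚ) ^ (2 * g) = 2 ^ (2 * h) * 2 ^ (2 * (g - h)) := by
      rw [← pow_add]
      congr 1
      omega
    rw [pow_add, e1, e2]
    field_simp
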